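/- The Max-Buying-PL-Limited Problem (limited supply, price ladder) is the following. An instance consists of $n$ items, $m$ bidders, a non-negative integer matrix $v$ (where $v_{ib}$ is the value of item $i$ to bidder $b$), and a non-negative integer $C_i$ for each item $i$ (its number of copies). A feasible solution is a pricing $p$ (a non-negative rational vector indexed by the items) with $p_1 \ge p_2 \ge \cdots \ge p_n$, together with an allocation $x$ that gives each bidder either no item or one item, such that each item $i$ is allocated to at most $C_i$ bidders and $p_i \le v_{ib}$ whenever item $i$ is allocated to bidder $b$. The goal is to maximize the profit, that is, the sum over all bidders that receive an item of the price of the item received. For every real $\varepsilon$ with $0 < \varepsilon < 1$, there is a polynomial-time $(2+\varepsilon)$-approximation algorithm for the Max-Buying-PL-Limited Problem: a deterministic algorithm (depending on $\varepsilon$) that, given an instance with all numbers written in binary, computes in time bounded by a polynomial (depending on $\varepsilon$) in the length of the instance a feasible solution whose profit $\mathrm{SOL}$ satisfies $\mathrm{OPT} \le (2+\varepsilon)\,\mathrm{SOL}$, where $\mathrm{OPT}$ is the maximum profit of a feasible solution. -/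

import Mathlib

/-! ### A random access machine with logarithmic cost

Programs are structured (assignment, sequencing, branching, loops).  The memory consists of arrays of
natural numbers; a program names its arrays by literals and computes the positions inside them, so
indirect addressing is available.  Every operation is charged the binary lengths of all the numbers
it touches (addresses, operands and results), so that the running time is a bit cost, polynomially
equivalent to the number of steps of a Turing machine. -/

namespace RAM

/-- `σ a k` is the number in position `k` of array `a`. -/
abbrev Mem := ℕ → ℕ → ℕ

/-- The charge for handling the number `x`: one more than its number of binary digits. -/
def len (x : ℕ) : ℕ := Nat.size x + 1

/-- The arithmetic of the machine: addition, subtraction truncated at zero, multiplication, and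
quotient of the division with remainder (division by zero gives zero). -/
inductive Op
  | add
  | sub
  | mul
  | div

def Op.apply : Op → ℕ → ℕ → ℕ
  | .add, x, y => x + y
  | .sub, x, y => x - y
  | .mul, x, y => x * y
  | .div, x, y => x / y

inductive Expr
  | const (x : ℕ)
  | read (a : ℕ) (e : Expr)
  | op (o : Op) (e f : Expr)

def Expr.eval (σ : Mem) : Expr → ℕ
  | .const x => x
  | .read a e => σ a (e.eval σ)
  | .op o e f => o.apply (e.eval σ) (f.eval σ)

/-- The logarithmic cost of evaluating an expression. -/
def Expr.cost (σ : Mem) : Expr → ℕ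
  | .const x => len x
  | .read a e => e.cost σ + len (e.eval σ) + len (σ a (e.eval σ))
  | .op o e f => e.cost σ + f.cost σ + len (e.eval σ) + len (f.eval σ)
      + len (o.apply (e.eval σ) (f.eval σ))

/-- Programs.  `write a e f` stores the value of `f` in position `e` of array `a`.
A test `e` holds when the value of `e` is not zero. -/
inductive Prog
  | skip
  | write (a : ℕ) (e f : Expr)
  | seq (c d : Prog)
  | ite (e : Expr) (c d : Prog)
  | loop (e : Expr) (c : Prog)

/-- The memory `σ` after storing `x` in position `k` of array `a`. -/
def Mem.set (σ : Mem) (a k x : ℕ) : Mem :=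
  fun a' k' => if a' = a ∧ k' = k then x else σ a' k'

/-- `Runs c σ τ T`: started in memory `σ`, the program `c` halts in memory `τ`
after time `T` (logarithmic cost). -/
inductive Runs : Prog → Mem → Mem → ℕ → Prop
  | skip (σ : Mem) : Runs .skip σ σ 1
  | write (σ : Mem) (a : ℕ) (e f : Expr) :
      Runs (.write a e f) σ (σ.set a (e.eval σ) (f.eval σ))
        (e.cost σ + f.cost σ + len (e.eval σ) + len (f.eval σ))
  | seq {c d : Prog} {σ τ υ : Mem} {S T : ℕ} (hc : Runs c σ τ S) (hd : Runs d τ υ T) :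
      Runs (.seq c d) σ υ (S + T)
  | ite_true {e : Expr} {c d : Prog} {σ τ : Mem} {T : ℕ} (he : e.eval σ ≠ 0)
      (hc : Runs c σ τ T) : Runs (.ite e c d) σ τ (e.cost σ + T)
  | ite_false {e : Expr} {c d : Prog} {σ τ : Mem} {T : ℕ} (he : e.eval σ = 0)
      (hd : Runs d σ τ T) : Runs (.ite e c d) σ τ (e.cost σ + T)
  | loop_halt {e : Expr} {c : Prog} {σ : Mem} (he : e.eval σ = 0) :
      Runs (.loop e c) σ σ (e.cost σ)
  | loop_next {e : Expr} {c : Prog} {σ τ υ : Mem} {S T : ℕ} (he : e.eval σ ≠ 0)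
      (hc : Runs c σ τ S) (hl : Runs (.loop e c) τ υ T) :
      Runs (.loop e c) σ υ (e.cost σ + S + T)

end RAM

/-! ### The Max-Buying-PL-Limited Problem -/

namespace MaxBuyingPLLimited

/-- An instance: `n` items, `m` bidders, the number `C i` of copies of each item,
and the valuation matrix `v`, where `v i b` is the value of item `i` to bidder `b`. -/
structure Instance where
  n : ℕ
  m : ℕ
  C : Fin n → ℕ
  v : Fin n → Fin m → ℕ

/-- A pricing (a non-negative rational vector) and an allocation of at most one item to each
bidder; `none` means that the bidder receives no item. -/
structure Solution (I : Instance) where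
  p : Fin I.n → NNRat
  x : Fin I.m → Option (Fin I.n)

/-- Feasibility: no item is sold more often than it has copies, every allocated item is feasible
for its bidder, and the prices respect the price ladder `p 1 ≥ p 2 ≥ ⋯ ≥ p n`. -/
structure Solution.Feasible {I : Instance} (S : Solution I) : Prop where
  supply : ∀ i, (Finset.univ.filter fun b => S.x b = some i).card ≤ I.C i
  affordable : ∀ b i, S.x b = some i → S.p i ≤ (I.v i b : NNRat)
  ladder : Antitone S.p

/-- The profit of the auctioneer: the sum over all bidders of the price of the item received. -/
def Solution.profit {I : Instance} (S : Solution I) : NNRat :=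
  ∑ b, (S.x b).elim 0 S.p

/-- `S` is a feasible solution whose profit is at least `1 / r` times the profit of every
feasible solution. -/
def Solution.IsApprox {I : Instance} (r : ℝ) (S : Solution I) : Prop :=
  S.Feasible ∧ ∀ S' : Solution I, S'.Feasible → (S'.profit : ℝ) ≤ r * (S.profit : ℝ)

/-- The length of the binary representation of an instance: one symbol for each item and bidder,
and the binary numbers `C i` and `v i b`, each followed by a separator. -/
def Instance.size (I : Instance) : ℕ :=
  I.n + I.m + ∑ i, RAM.len (I.C i) + ∑ i, ∑ b, RAM.len (I.v i b)

/-- The initial memory of a machine that is given the instance `I`: array `0` holds the numbers of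
items and of bidders, array `1` the numbers of copies, and array `2` the valuation matrix, row by
row; everything else is zero. -/
def Instance.input (I : Instance) : RAM.Mem := fun a k =>
  if a = 0 then (if k = 0 then I.n else if k = 1 then I.m else 0)
  else if a = 1 then (if h : k < I.n then I.C ⟨k, h⟩ else 0)
  else if a = 2 then
    (if h : k / I.m < I.n ∧ k % I.m < I.m then I.v ⟨k / I.m, h.1⟩ ⟨k % I.m, h.2⟩ else 0)
  else 0

/-- The memory `τ` represents the solution `S`: arrays `3` and `4` hold numerators and (non-zero)
denominators of the prices, and array `5` holds, for each bidder, `0` if the bidder receives no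
item and `i + 1` if the bidder receives the item with index `i` (indices start at `0`). -/
def Solution.IsOutput {I : Instance} (S : Solution I) (τ : RAM.Mem) : Prop :=
  (∀ i : Fin I.n, τ 4 i ≠ 0 ∧ S.p i = (τ 3 i : NNRat) / (τ 4 i : NNRat)) ∧
  ∀ b : Fin I.m, τ 5 b = (S.x b).elim 0 fun i => (i : ℕ) + 1

/-- There is a polynomial-time `r`-approximation algorithm for the Max-Buying-PL-Limited Problem:
a program that, on every instance, halts within time polynomial in the length of the instance, with
a feasible solution in memory whose profit is at least the optimum divided by `r`. -/
def HasPolyTimeApprox (r : ℝ) : Prop :=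
  ∃ (c : RAM.Prog) (q : Polynomial ℕ), ∀ I : Instance, ∃ (τ : RAM.Mem) (T : ℕ),
    RAM.Runs c I.input τ T ∧ T ≤ q.eval I.size ∧
      ∃ S : Solution I, S.IsOutput τ ∧ S.IsApprox r

end MaxBuyingPLLimited

/-! Fix a large integer B. Rounding prices up to integers keeps a solution feasible, because the
values are integers. Rounding them down to the `level`s, which grow by a factor of about 1 + 1/B,
then costs a factor of at most (B+1)/B (`exists_levels`). Only polynomially many levels lie below
the largest value (`two_pow_le_level`).

Cut the levels into blocks of K = B²(B+1) consecutive levels and sell nothing at the highest G = B²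
levels of each block. Averaging over the K positions of the cuts shows that some position loses at
most a factor K/(K-G) = (B+1)/B (`card_window`, `sub_mul_sum_pay_le`). By the price ladder, the
assignment of a block's levels to items is given by K+1 thresholds, a constant number, so all
choices can be tried. Once the prices in a block are fixed, the allocation problem that remains is
solved within a factor 2 by offering the items in the order of decreasing price
(`sum_pay_le_two_mul`).

The blocks are optimized independently by dynamic programming over pairs (upper bound on the level,
first item), so two blocks may both serve the same bidder. That bidder keeps the item of the higher
block. Because of the gap of G unused levels, the item given up costs at most 1/(B+1) of the one
kept, and charging it to the item kept costs one further factor (B+1)/B in total, not one per block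
(`IsPartial.extend`). Conversely, the table dominates half the gapped profit of every solution that
uses levels as prices (`blockProfit_le`). Altogether the ratio is 2(1 + 1/B)³, which is at most 2 +
ε once εB ≥ 14 (`isApprox_of_table`).

For the running time, programs are built from loops whose bounds are stored in an array that they
never modify, and they store only expressions to whose values products contribute solely through
addresses and divisors. Each assignment then lengthens the numbers by a constant number of digits,
so time and number length are polynomial in the loop bounds and the input length (`BProg.runs`). The
number of levels is found beforehand by a separate doubling loop (`exists_polyRuns`). -/

section
open Finset

namespace RAM

/-! ### Logarithmic cost of expressions -/

/-- All numbers in the memory have at most `l` binary digits. -/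
def Mem.Bounded (σ : Mem) (l : ℕ) : Prop := ∀ a k, Nat.size (σ a k) ≤ l

theorem Mem.Bounded.mono {σ : Mem} {l l' : ℕ} (h : σ.Bounded l) (hl : l ≤ l') : σ.Bounded l' :=
  fun a k => (h a k).trans hl

theorem Mem.Bounded.set {σ : Mem} {l a k x : ℕ} (h : σ.Bounded l) (hx : Nat.size x ≤ l) :
    (σ.set a k x).Bounded l := by
  intro a' k'
  unfold Mem.set
  split_ifs
  · exact hx
  · exact h _ _

theorem Mem.set_row_of_ne {σ : Mem} {a a' k x : ℕ} (h : a' ≠ a) : (σ.set a k x) a' = σ a' := by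
  funext k'
  simp [Mem.set, h]

theorem Mem.set_apply_same_row (σ : Mem) (a k x k' : ℕ) :
    (σ.set a k x) a k' = if k' = k then x else σ a k' := by
  simp [Mem.set]

theorem size_add_le (x y : ℕ) : Nat.size (x + y) ≤ Nat.size x + Nat.size y + 1 := by
  rw [Nat.size_le]
  have hx := Nat.lt_size_self x
  have hy := Nat.lt_size_self y
  have h1 : 2 ^ Nat.size x ≤ 2 ^ (Nat.size x + Nat.size y) := Nat.pow_le_pow_right (by norm_num) (by omega)
  have h2 : 2 ^ Nat.size y ≤ 2 ^ (Nat.size x + Nat.size y) := Nat.pow_le_pow_right (by norm_num) (by omega)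
  rw [pow_succ]
  omega

theorem size_mul_le (x y : ℕ) : Nat.size (x * y) ≤ Nat.size x + Nat.size y := by
  rw [Nat.size_le, pow_add]
  exact Nat.mul_lt_mul'' (Nat.lt_size_self x) (Nat.lt_size_self y)

/-- The extra 1 in each operand's charge absorbs the carry of an addition; thus the charge for a
result is always covered by the charges for its operands. -/
theorem len_apply_le (o : Op) (x y : ℕ) : len (o.apply x y) ≤ len x + len y := by
  unfold len
  cases o <;> simp only [Op.apply]
  · have := size_add_le x y; omega
  · have := Nat.size_le_size (Nat.sub_le x y); omega
  · have := size_mul_le x y; omega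
  · have := Nat.size_le_size (Nat.div_le_self x y); omega

namespace Expr

theorem len_eval_le_cost (σ : Mem) (e : Expr) : len (e.eval σ) ≤ e.cost σ := by
  cases e <;> simp only [eval, cost] <;> omega

/-- The cost of `e` is at most `e.weight` times the number of digits of the numbers in memory. -/
def weight : Expr → ℕ
  | .const x => len x
  | .read _ e => 2 * e.weight + 1
  | .op _ e f => 3 * (e.weight + f.weight)

/-- The length of a value never exceeds the cost of computing it. A read therefore at most doubles
the cost of its address, up to the length of the cell, and an operation at most triples the cost of
its operands. -/
theorem cost_le (σ : Mem) (l : ℕ) (h : σ.Bounded l) (e : Expr) :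
    e.cost σ ≤ e.weight * (l + 1) := by
  induction e with
  | const x => simp only [cost, weight]; nlinarith [Nat.zero_le (len x * l)]
  | read a e ih =>
    simp only [cost, weight]
    have h1 := len_eval_le_cost σ e
    have h2 : len (σ a (e.eval σ)) ≤ l + 1 := Nat.succ_le_succ (h _ _)
    linarith
  | op o e f ihe ihf =>
    simp only [cost, weight]
    have h1 := len_eval_le_cost σ e
    have h2 := len_eval_le_cost σ f
    have h3 := len_apply_le o (e.eval σ) (f.eval σ)
    linarith

/-- No product contributes to the value of the expression, except through addresses and
divisors. -/
def Additive : Expr → Prop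
  | .const _ => True
  | .read _ _ => True
  | .op .add e f => e.Additive ∧ f.Additive
  | .op .sub e _ => e.Additive
  | .op .mul _ _ => False
  | .op .div e _ => e.Additive

/-- The number of digits by which the value of an additive expression may exceed the numbers
in memory. -/
def growth : Expr → ℕ
  | .const x => Nat.size x
  | .read _ _ => 0
  | .op _ e f => e.growth + f.growth + 1

/-- A sum has one digit more than its longer summand, whereas a product would add the lengths.
Without products the excess over `l` is a constant of the expression; iterated squaring, which
produces exponentially long numbers, is thereby ruled out. -/
theorem size_eval_le (σ : Mem) (l : ℕ) (h : σ.Bounded l) (e : Expr) (he : e.Additive) :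
    Nat.size (e.eval σ) ≤ l + e.growth := by
  induction e with
  | const x => simp [eval, growth]
  | read a e ih => simpa [eval, growth] using h _ _
  | op o e f ihe ihf =>
    cases o <;> simp only [Additive] at he <;> simp only [eval, growth, Op.apply]
    · have h1 := ihe he.1
      have h2 := ihf he.2
      rw [Nat.size_le] at h1 h2 ⊢
      have h3 : 2 ^ (l + e.growth) ≤ 2 ^ (l + (e.growth + f.growth)) :=
        Nat.pow_le_pow_right (by norm_num) (by omega)
      have h4 : 2 ^ (l + f.growth) ≤ 2 ^ (l + (e.growth + f.growth)) :=
        Nat.pow_le_pow_right (by norm_num) (by omega)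
      rw [← add_assoc, pow_succ]
      omega
    · have := Nat.size_le_size (Nat.sub_le (e.eval σ) (f.eval σ))
      have := ihe he
      omega
    · have := Nat.size_le_size (Nat.div_le_self (e.eval σ) (f.eval σ))
      have := ihe he
      omega

instance : Add Expr := ⟨Expr.op .add⟩
instance : Sub Expr := ⟨Expr.op .sub⟩
instance : Mul Expr := ⟨Expr.op .mul⟩
instance : Div Expr := ⟨Expr.op .div⟩
instance : Zero Expr := ⟨Expr.const 0⟩
instance : One Expr := ⟨Expr.const 1⟩

@[simp] theorem eval_add (σ : Mem) (e f : Expr) : (e + f).eval σ = e.eval σ + f.eval σ := rfl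
@[simp] theorem eval_sub (σ : Mem) (e f : Expr) : (e - f).eval σ = e.eval σ - f.eval σ := rfl
@[simp] theorem eval_mul (σ : Mem) (e f : Expr) : (e * f).eval σ = e.eval σ * f.eval σ := rfl
@[simp] theorem eval_div (σ : Mem) (e f : Expr) : (e / f).eval σ = e.eval σ / f.eval σ := rfl
@[simp] theorem eval_zero (σ : Mem) : (0 : Expr).eval σ = 0 := rfl
@[simp] theorem eval_one (σ : Mem) : (1 : Expr).eval σ = 1 := rfl
@[simp] theorem eval_const (σ : Mem) (n : ℕ) : (const n).eval σ = n := rfl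
@[simp] theorem eval_read (σ : Mem) (a : ℕ) (e : Expr) : (read a e).eval σ = σ a (e.eval σ) := rfl

@[simp] theorem additive_add (e f : Expr) : (e + f).Additive ↔ e.Additive ∧ f.Additive := Iff.rfl
@[simp] theorem additive_sub (e f : Expr) : (e - f).Additive ↔ e.Additive := Iff.rfl
@[simp] theorem additive_div (e f : Expr) : (e / f).Additive ↔ e.Additive := Iff.rfl
@[simp] theorem additive_zero : (0 : Expr).Additive := trivial
@[simp] theorem additive_one : (1 : Expr).Additive := trivial
@[simp] theorem additive_const (n : ℕ) : (const n).Additive := trivial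
@[simp] theorem additive_read (a : ℕ) (e : Expr) : (read a e).Additive := trivial

/-- The content of position `0` of array `a`, used as a variable. -/
def var (a : ℕ) : Expr := read a 0

@[simp] theorem eval_var (σ : Mem) (a : ℕ) : (var a).eval σ = σ a 0 := rfl
@[simp] theorem additive_var (a : ℕ) : (var a).Additive := trivial

end Expr

/-! ### Programs with bounded loops -/

/-- The array that holds the bounds of the loops. -/
abbrev bnd : ℕ := 6

/-- Programs with bounded loops: `iter i p c` executes `c` with the values `0, 1, …` of the
variable `i`, as often as position `p` of the array `bnd` says. -/
inductive BProg
  | skip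
  | write (a : ℕ) (e f : Expr)
  | seq (c d : BProg)
  | ite (e : Expr) (c d : BProg)
  | iter (i p : ℕ) (c : BProg)

/-- The test of a bounded loop. -/
def Expr.iterTest (i p : ℕ) : Expr := .read bnd (.const p) - .var i

namespace BProg

def toProg : BProg → Prog
  | .skip => .skip
  | .write a e f => .write a e f
  | .seq c d => .seq c.toProg d.toProg
  | .ite e c d => .ite e c.toProg d.toProg
  | .iter i p c => .seq (.write i 0 0)
      (.loop (.iterTest i p) (.seq c.toProg (.write i 0 (.var i + 1))))

def exec : BProg → Mem → Mem
  | .skip, σ => σ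
  | .write a e f, σ => σ.set a (e.eval σ) (f.eval σ)
  | .seq c d, σ => d.exec (c.exec σ)
  | .ite e c d, σ => if e.eval σ ≠ 0 then c.exec σ else d.exec σ
  | .iter i p c, σ =>
      Nat.rec (σ.set i 0 0) (fun k τ => (c.exec τ).set i 0 (k + 1)) (σ bnd p)

/-- The program contains an assignment to array `a`. -/
def Writes : BProg → ℕ → Prop
  | .skip, _ => False
  | .write b _ _, a => a = b
  | .seq c d, a => c.Writes a ∨ d.Writes a
  | .ite _ c d, a => c.Writes a ∨ d.Writes a
  | .iter i _ c, a => a = i ∨ c.Writes a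

/-- All stored values are additive expressions, and loops do not change their own counters. -/
def WF : BProg → Prop
  | .skip => True
  | .write _ _ f => f.Additive
  | .seq c d => c.WF ∧ d.WF
  | .ite _ c d => c.WF ∧ d.WF
  | .iter i _ c => c.WF ∧ ¬ c.Writes i

/-- The frame rule: correctness arguments need to follow only the arrays that a program assigns to.
-/
theorem exec_row {c : BProg} {a : ℕ} (h : ¬ c.Writes a) (σ : Mem) : c.exec σ a = σ a := by
  induction c generalizing σ with
  | skip => rfl
  | write b e f => exact Mem.set_row_of_ne h
  | seq c d ihc ihd =>
    simp only [Writes, not_or] at h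
    simp only [exec]
    rw [ihd h.2, ihc h.1]
  | ite e c d ihc ihd =>
    simp only [Writes, not_or] at h
    simp only [exec]
    split_ifs
    · exact ihc h.1 σ
    · exact ihd h.2 σ
  | iter i p c ih =>
    simp only [Writes, not_or] at h
    simp only [exec]
    generalize σ bnd p = N
    induction N with
    | zero => exact Mem.set_row_of_ne h.1
    | succ k ihk => exact (Mem.set_row_of_ne h.1).trans ((ih h.2 _).trans ihk)

/-- The invariant rule for bounded loops. -/
theorem exec_iter (Inv : ℕ → Mem → Prop) {i p N : ℕ} {c : BProg} {σ : Mem} (hN : σ bnd p = N) (h0 : Inv 0 (σ.set i 0 0))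
    (hs : ∀ k τ, k < N → τ i 0 = k → Inv k τ → Inv (k + 1) ((c.exec τ).set i 0 (k + 1))) :
    Inv N ((iter i p c).exec σ) := by
  simp only [exec, hN]
  suffices h : ∀ k, k ≤ N → Inv k (Nat.rec (motive := fun _ => Mem) (σ.set i 0 0)
      (fun k τ => (c.exec τ).set i 0 (k + 1)) k) ∧ (Nat.rec (motive := fun _ => Mem) (σ.set i 0 0)
      (fun k τ => (c.exec τ).set i 0 (k + 1)) k : Mem) i 0 = k from (h N le_rfl).1
  intro k
  induction k with
  | zero => exact fun _ => ⟨h0, by simp [Mem.set]⟩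
  | succ k ih =>
    intro hk
    obtain ⟨h1, h2⟩ := ih (by omega)
    exact ⟨hs k _ (by omega) h2 h1, by simp [Mem.set]⟩

/-! ### Running time of programs with bounded loops -/

/-- The number of digits by which the numbers in memory may grow during the execution, if all loop
bounds are at most `X`. -/
def grow : BProg → ℕ → ℕ
  | .skip, _ => 0
  | .write _ _ f, _ => f.growth
  | .seq c d, X => c.grow X + d.grow X
  | .ite _ c d, X => c.grow X + d.grow X
  | .iter _ _ c, X => X * (c.grow X + 2)

/-- The time of the execution, divided by the number of digits of the numbers involved, if all loop
bounds are at most `X`. -/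
def time : BProg → ℕ → ℕ
  | .skip, _ => 1
  | .write _ e f, _ => 2 * (e.weight + f.weight)
  | .seq c d, X => c.time X + d.time X
  | .ite e c d, X => e.weight + c.time X + d.time X
  | .iter i p c, X => 4 + (X + 1) *
      ((Expr.iterTest i p).weight + (c.time X + 2 * ((0 : Expr).weight + (.var i + 1 : Expr).weight)))

end BProg

/-- The factor is `N + 1` because the test is evaluated once more than the body. -/
theorem runs_loop_iterate {e : Expr} {c : Prog} {f : ℕ → Mem} {N W : ℕ}
    (hrun : ∀ k < N, ∃ T, Runs c (f k) (f (k + 1)) T ∧ (e.cost (f k)) + T ≤ W)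
    (htest : ∀ k < N, e.eval (f k) ≠ 0) (hhalt : e.eval (f N) = 0) (hcost : e.cost (f N) ≤ W) :
    ∃ T, Runs (.loop e c) (f 0) (f N) T ∧ T ≤ (N + 1) * W := by
  induction N generalizing f with
  | zero => exact ⟨_, .loop_halt hhalt, by simpa using hcost⟩
  | succ N ih =>
    obtain ⟨T₁, hr, hT₁⟩ := hrun 0 (by omega)
    obtain ⟨T₂, hl, hT₂⟩ := ih (f := fun k => f (k + 1))
      (fun k hk => hrun (k + 1) (by omega)) (fun k hk => htest (k + 1) (by omega)) hhalt hcost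
    refine ⟨_, .loop_next (htest 0 (by omega)) hr hl, ?_⟩
    rw [add_mul _ 1]
    omega

theorem runs_write (σ : Mem) (a : ℕ) (e f : Expr) {l : ℕ} (hσ : σ.Bounded l) :
    ∃ T, Runs (.write a e f) σ (σ.set a (e.eval σ) (f.eval σ)) T ∧
      T ≤ 2 * (e.weight + f.weight) * (l + 1) := by
  refine ⟨_, .write σ a e f, ?_⟩
  have h1 := e.cost_le σ l hσ
  have h2 := f.cost_le σ l hσ
  have h3 := e.len_eval_le_cost σ
  have h4 := f.len_eval_le_cost σ
  linarith

namespace BProg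

/-- Time and number length are bounded together, since the cost of a later step depends on how long
the numbers have become. As the array of loop bounds is never written, the bound `X` holds at every
point of the execution, including inside nested loops. -/
theorem runs (X : ℕ) {c : BProg} (hc : c.WF) (hb : ¬ c.Writes bnd) {σ : Mem} {l : ℕ}
    (hσ : σ.Bounded l) (hX : ∀ p, σ bnd p ≤ X) :
    (∃ T, Runs c.toProg σ (c.exec σ) T ∧ T ≤ c.time X * (l + c.grow X + 1)) ∧
      (c.exec σ).Bounded (l + c.grow X) := by
  induction c generalizing σ l with
  | skip => exact ⟨⟨1, .skip σ, by simp [time, grow]⟩, hσ⟩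
  | write a e f =>
    refine ⟨?_, (hσ.mono (Nat.le_add_right _ _)).set (f.size_eval_le σ l hσ hc)⟩
    obtain ⟨T, hT, hT'⟩ := runs_write σ a e f hσ
    exact ⟨T, hT, hT'.trans (Nat.mul_le_mul_left _ (by omega))⟩
  | seq c d ihc ihd =>
    simp only [Writes, not_or] at hb
    obtain ⟨⟨S, hS, hS'⟩, h1⟩ := ihc hc.1 hb.1 hσ hX
    obtain ⟨⟨T, hT, hT'⟩, h2⟩ := ihd hc.2 hb.2 h1 (by simpa [exec_row hb.1] using hX)
    refine ⟨⟨_, .seq hS hT, ?_⟩, h2.mono (by simp only [grow]; omega)⟩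
    simp only [time, grow]
    calc S + T ≤ c.time X * (l + (c.grow X + d.grow X) + 1)
          + d.time X * (l + (c.grow X + d.grow X) + 1) :=
        add_le_add (hS'.trans (Nat.mul_le_mul_left _ (by omega)))
          (hT'.trans (Nat.mul_le_mul_left _ (by omega)))
      _ = _ := by ring
  | ite e c d ihc ihd =>
    simp only [Writes, not_or] at hb
    have he := (e.cost_le σ l hσ).trans (Nat.mul_le_mul_left e.weight
      (show l + 1 ≤ l + (c.grow X + d.grow X) + 1 by omega))
    simp only [time, grow, exec, toProg]
    obtain ⟨⟨S, hS, hS'⟩, h1⟩ := ihc hc.1 hb.1 hσ hX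
    obtain ⟨⟨T, hT, hT'⟩, h2⟩ := ihd hc.2 hb.2 hσ hX
    replace hS' := hS'.trans (Nat.mul_le_mul_left _
      (show l + c.grow X + 1 ≤ l + (c.grow X + d.grow X) + 1 by omega))
    replace hT' := hT'.trans (Nat.mul_le_mul_left _
      (show l + d.grow X + 1 ≤ l + (c.grow X + d.grow X) + 1 by omega))
    rw [add_mul, add_mul]
    split_ifs with h
    · exact ⟨⟨_, .ite_true h hS, by omega⟩, h1.mono (by omega)⟩
    · exact ⟨⟨_, .ite_false (not_not.mp h) hT, by omega⟩, h2.mono (by omega)⟩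
  | iter i p c ih =>
    simp only [Writes, not_or] at hb
    set N := σ bnd p with hN
    have hNX : N ≤ X := hX p
    let f : ℕ → Mem := fun k => Nat.rec (motive := fun _ => Mem) (σ.set i 0 0)
      (fun k τ => (c.exec τ).set i 0 (k + 1)) k
    have hf0 : f 0 = σ.set i 0 0 := rfl
    have hfs : ∀ k, f (k + 1) = (c.exec (f k)).set i 0 (k + 1) := fun _ => rfl
    have hexec : (iter i p c).exec σ = f N := rfl
    have hfi : ∀ k, f k i 0 = k := by
      rintro (_ | k)
      · simp [hf0, Mem.set]
      · simp [hfs, Mem.set]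
    have hfb : ∀ k, f k bnd = σ bnd := by
      intro k
      induction k with
      | zero => exact Mem.set_row_of_ne hb.1
      | succ k ihk => rw [hfs, Mem.set_row_of_ne hb.1, exec_row hb.2, ihk]
    have hstep : ∀ k, (f k).Bounded (l + k * (c.grow X + 2)) →
        (∃ T, Runs (.seq c.toProg (.write i 0 (.var i + 1))) (f k) (f (k + 1)) T ∧
          T ≤ (c.time X + 2 * ((0 : Expr).weight + (.var i + 1 : Expr).weight)) *
            (l + (k + 1) * (c.grow X + 2) + 1)) ∧
        (f (k + 1)).Bounded (l + (k + 1) * (c.grow X + 2)) := by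
      intro k hk
      obtain ⟨⟨S, hS, hS'⟩, h1⟩ := ih hc.1 hb.2 hk (by simpa [hfb] using hX)
      have hw := runs_write (c.exec (f k)) i 0 (.var i + 1) h1
      have hval : (Expr.var i + 1).eval (c.exec (f k)) = k + 1 := by
        simp [exec_row hc.2, hfi]
      have hsz := (Expr.var i + 1).size_eval_le _ _ h1 ⟨trivial, trivial⟩
      rw [hval] at hw hsz
      -- One digit for the constant 1 and one for the carry: this is the `+ 2` per pass in `grow`.
      have hg : (Expr.var i + 1).growth = 2 := rfl
      obtain ⟨T, hT, hT'⟩ := hw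
      rw [hg] at hsz
      have e1 : l + k * (c.grow X + 2) + c.grow X + 2 = l + (k + 1) * (c.grow X + 2) := by ring
      refine ⟨⟨_, .seq hS hT, ?_⟩, ?_⟩
      · rw [add_mul]
        exact add_le_add (hS'.trans (Nat.mul_le_mul_left _ (by omega)))
          (hT'.trans (Nat.mul_le_mul_left _ (by omega)))
      · rw [hfs]
        exact (h1.mono (by omega)).set (by omega)
    have hbd : ∀ k, (f k).Bounded (l + k * (c.grow X + 2)) := by
      intro k
      induction k with
      | zero => exact (hσ.mono (by omega)).set (by simp)
      | succ k ihk => exact (hstep k ihk).2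
    have hle : ∀ k ≤ N, l + k * (c.grow X + 2) ≤ l + (iter i p c).grow X := by
      intro k hk
      simp only [grow]
      gcongr
      omega
    set M := l + (iter i p c).grow X with hM
    rw [hexec]
    refine ⟨?_, (hbd N).mono (hle N le_rfl)⟩
    have hcost : ∀ k ≤ N, (Expr.iterTest i p).cost (f k) ≤ (Expr.iterTest i p).weight * (M + 1) :=
      fun k hk => Expr.cost_le _ _ ((hbd k).mono (hle k hk)) _
    have htest : ∀ k, (Expr.iterTest i p).eval (f k) = N - k := by
      intro k
      simp [Expr.iterTest, hfb, hfi, hN]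
    obtain ⟨T, hT, hT'⟩ := runs_loop_iterate (e := .iterTest i p)
      (c := .seq c.toProg (.write i 0 (.var i + 1))) (f := f) (N := N)
      (W := ((Expr.iterTest i p).weight +
        (c.time X + 2 * ((0 : Expr).weight + (.var i + 1 : Expr).weight))) * (M + 1))
      (by
        intro k hk
        obtain ⟨T, hT, hT'⟩ := (hstep k (hbd k)).1
        refine ⟨T, hT, ?_⟩
        rw [add_mul]
        exact add_le_add (hcost k hk.le) (hT'.trans (Nat.mul_le_mul_left _
          (Nat.succ_le_succ (hle (k + 1) hk)))))
      (by intro k hk; rw [htest]; omega) (by simp [htest])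
      ((hcost N le_rfl).trans (Nat.mul_le_mul_right _ (Nat.le_add_right _ _)))
    obtain ⟨S, hS, hS'⟩ := runs_write σ i 0 0 hσ
    refine ⟨_, .seq hS hT, ?_⟩
    have h0 : 2 * ((0 : Expr).weight + (0 : Expr).weight) = 4 := rfl
    rw [h0] at hS'
    simp only [time]
    rw [add_mul, mul_assoc]
    exact add_le_add (hS'.trans (Nat.mul_le_mul_left _ (by omega)))
      (hT'.trans (Nat.mul_le_mul_right _ (by omega)))

end BProg

/-! ### Polynomial bounds -/

/-- The function is bounded by a polynomial. -/
def PolyBounded (f : ℕ → ℕ) : Prop := ∃ q : Polynomial ℕ, ∀ x, f x ≤ q.eval x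

namespace PolyBounded

theorem const (k : ℕ) : PolyBounded fun _ => k := ⟨Polynomial.C k, by simp⟩

theorem id : PolyBounded fun x => x := ⟨Polynomial.X, by simp⟩

theorem add {f g : ℕ → ℕ} (hf : PolyBounded f) (hg : PolyBounded g) :
    PolyBounded fun x => f x + g x := by
  obtain ⟨p, hp⟩ := hf
  obtain ⟨q, hq⟩ := hg
  exact ⟨p + q, fun x => by simpa using add_le_add (hp x) (hq x)⟩

theorem mul {f g : ℕ → ℕ} (hf : PolyBounded f) (hg : PolyBounded g) :
    PolyBounded fun x => f x * g x := by
  obtain ⟨p, hp⟩ := hf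
  obtain ⟨q, hq⟩ := hg
  exact ⟨p * q, fun x => by simpa using Nat.mul_le_mul (hp x) (hq x)⟩

theorem comp {f g : ℕ → ℕ} (hf : PolyBounded f) (hg : PolyBounded g) (hm : Monotone f) :
    PolyBounded fun x => f (g x) := by
  obtain ⟨p, hp⟩ := hf
  obtain ⟨q, hq⟩ := hg
  exact ⟨p.comp q, fun x => by simpa using (hm (hq x)).trans (hp _)⟩

end PolyBounded

namespace BProg

theorem grow_polyBounded (c : BProg) : PolyBounded c.grow := by
  induction c with
  | skip => exact .const 0
  | write a e f => exact .const _
  | seq c d ihc ihd => exact ihc.add ihd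
  | ite e c d ihc ihd => exact ihc.add ihd
  | iter i p c ih => exact .mul .id (ih.add (.const 2))

theorem time_polyBounded (c : BProg) : PolyBounded c.time := by
  induction c with
  | skip => exact .const 1
  | write a e f => exact .const _
  | seq c d ihc ihd => exact ihc.add ihd
  | ite e c d ihc ihd => exact ((PolyBounded.const _).add ihc).add ihd
  | iter i p c ih =>
    exact (PolyBounded.const 4).add
      ((PolyBounded.id.add (.const 1)).mul ((PolyBounded.const _).add (ih.add (.const _))))

theorem grow_mono (c : BProg) : Monotone c.grow := by
  induction c with
  | skip => exact monotone_const
  | write a e f => exact monotone_const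
  | seq c d ihc ihd => exact ihc.add ihd
  | ite e c d ihc ihd => exact ihc.add ihd
  | iter i p c ih => exact fun x y h => Nat.mul_le_mul h (Nat.add_le_add_right (ih h) 2)

theorem time_mono (c : BProg) : Monotone c.time := by
  induction c with
  | skip => exact monotone_const
  | write a e f => exact monotone_const
  | seq c d ihc ihd => exact ihc.add ihd
  | ite e c d ihc ihd =>
    exact fun x y h =>
      add_le_add (Nat.add_le_add_left (ihc h) _) (ihd h)
  | iter i p c ih =>
    exact fun x y h => Nat.add_le_add_left (Nat.mul_le_mul
      (Nat.add_le_add_right h 1) (Nat.add_le_add_left (Nat.add_le_add_right (ih h) _) _)) 4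

end BProg
end RAM

namespace MaxBuyingPLLimited
open RAM

/-! ### Allocations with fixed prices -/

/-- What bidder `b` pays in allocation `X` (`0` for no item, `i + 1` for item `i`). -/
def pay (P X : ℕ → ℕ) (b : ℕ) : ℕ := if X b = 0 then 0 else P (X b - 1)

/-- The number of copies of item `i` sold by allocation `X` to the first `m` bidders. -/
def sold (m : ℕ) (X : ℕ → ℕ) (i : ℕ) : ℕ := #{b ∈ range m | X b = i + 1}

/-- `X` allocates at most `cap i` copies of each item `i` at affordable prices. -/
structure IsAlloc (n m : ℕ) (v : ℕ → ℕ → ℕ) (cap P X : ℕ → ℕ) : Prop where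
  le : ∀ b < m, X b ≤ n
  afford : ∀ b < m, ∀ i, X b = i + 1 → P i ≤ v i b
  supply : ∀ i < n, sold m X i ≤ cap i

/-- Double counting: a sum over served bidders is regrouped by the item received. -/
theorem sum_eq_sum_sold {n m : ℕ} {X : ℕ → ℕ} (hX : ∀ b < m, X b ≤ n) (f : ℕ → ℕ) :
    ∑ b ∈ range m, (if X b = 0 then 0 else f (X b - 1)) = ∑ i ∈ range n, f i * sold m X i := by
  have h : ∀ b ∈ range m, (if X b = 0 then 0 else f (X b - 1)) =
      ∑ i ∈ range n, if X b = i + 1 then f i else 0 := by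
    intro b hb
    have hb := hX b (mem_range.mp hb)
    by_cases h0 : X b = 0
    · rw [if_pos h0, sum_eq_zero]
      intro i _
      rw [if_neg (by omega)]
    · rw [if_neg h0, sum_eq_single (X b - 1)]
      · rw [if_pos (by omega)]
      · intro i _ hi
        rw [if_neg (by omega)]
      · intro hi
        rw [mem_range] at hi
        omega
  rw [sum_congr rfl h, sum_comm]
  refine sum_congr rfl fun i _ => ?_
  rw [← sum_filter, sum_const, smul_eq_mul, mul_comm, sold]

/-- An allocation in which every bidder either gets an item at least as good as any affordable
item, or finds that item sold out, is a 2-approximation. -/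
theorem sum_pay_le_two_mul {n m : ℕ} {v : ℕ → ℕ → ℕ} {cap P x y : ℕ → ℕ}
    (hP : ∀ i j, i ≤ j → j < n → P j ≤ P i)
    (hy : ∀ b < m, y b ≤ n)
    (hstable : ∀ i < n, ∀ b < m, P i ≤ v i b → (0 < y b ∧ y b ≤ i + 1) ∨ cap i ≤ sold m y i)
    (hx : IsAlloc n m v cap P x) :
    ∑ b ∈ range m, pay P x b ≤ 2 * ∑ b ∈ range m, pay P y b := by
  -- The price of an item if `y` sells it out. A bidder served by `x` is charged either to the own
  -- payment in `y` or to `f`; the second charges add up to at most the revenue of `y`, since `x`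
  -- sells no more copies of a sold-out item than `y` does.
  set f : ℕ → ℕ := fun i => if cap i ≤ sold m y i then P i else 0
  have h1 : ∀ b ∈ range m, pay P x b ≤
      pay P y b + if x b = 0 then 0 else f (x b - 1) := by
    intro b hb
    have hb := mem_range.mp hb
    by_cases h0 : x b = 0
    · simp [pay, h0]
    · obtain ⟨i, hi⟩ := Nat.exists_eq_succ_of_ne_zero h0
      have hin : i < n := by have := hx.le b hb; omega
      simp only [pay, hi, Nat.succ_eq_add_one, Nat.add_eq_zero_iff, one_ne_zero, and_false,
        if_false, Nat.add_sub_cancel, f]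
      rcases hstable i hin b hb (hx.afford b hb i hi) with h | h
      · rw [if_neg (by omega)]
        exact (hP _ _ (by omega) hin).trans (Nat.le_add_right _ _)
      · rw [if_pos h]
        exact Nat.le_add_left _ _
  have h2 : ∑ i ∈ range n, f i * sold m x i ≤ ∑ i ∈ range n, P i * sold m y i := by
    refine sum_le_sum fun i hi => ?_
    simp only [f]
    split_ifs with h
    · exact Nat.mul_le_mul_left _ ((hx.supply i (mem_range.mp hi)).trans h)
    · simp
  calc ∑ b ∈ range m, pay P x b ≤ _ := sum_le_sum h1
    _ = ∑ b ∈ range m, pay P y b + ∑ i ∈ range n, f i * sold m x i := by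
      rw [sum_add_distrib, sum_eq_sum_sold hx.le]
    _ ≤ ∑ b ∈ range m, pay P y b + ∑ i ∈ range n, P i * sold m y i := Nat.add_le_add_left h2 _
    _ = _ := by rw [← sum_eq_sum_sold hy, two_mul]; rfl

/-! ### Price levels -/

/-- The integers that serve as prices: each exceeds the previous one by a factor of about
`1 + 1 / B`. -/
def level (B : ℕ) : ℕ → ℕ
  | 0 => 0
  | k + 1 => level B k + level B k / B + 1

theorem level_strictMono (B : ℕ) : StrictMono (level B) :=
  strictMono_nat_of_lt_succ fun _ =>
    Nat.lt_succ_of_le (Nat.le_add_right _ _)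

theorem level_mono (B : ℕ) : Monotone (level B) := (level_strictMono B).monotone

/-- Each of the `j` steps adds ⌊x/B⌋ + 1, which exceeds x/B, at a level x not below the starting
level. Linear growth is enough for the uses below. -/
theorem le_mul_level_add {B : ℕ} (hB : 0 < B) (k j : ℕ) :
    (B + j) * level B k ≤ B * level B (k + j) := by
  induction j with
  | zero => rfl
  | succ j ih =>
    have h1 : level B (k + j) ≤ B * (level B (k + j) / B) + B := by
      have := Nat.div_add_mod (level B (k + j)) B
      have := Nat.mod_lt (level B (k + j)) hB
      omega
    have h2 : level B k ≤ level B (k + j) := level_mono B (by omega)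
    rw [← add_assoc k j 1, level]
    linarith

/-- By the previous lemma `B` steps double the level, starting from level 1, which has the value 1.
-/
theorem two_pow_le_level {B : ℕ} (hB : 0 < B) (j : ℕ) : 2 ^ j ≤ level B (1 + B * j) := by
  induction j with
  | zero => simp [level]
  | succ j ih =>
    have h := le_mul_level_add hB (1 + B * j) B
    have h' : 2 * level B (1 + B * j) ≤ level B (1 + B * j + B) := by
      refine Nat.le_of_mul_le_mul_left ?_ hB
      linarith
    rw [pow_succ, mul_add, mul_one, ← add_assoc]
    omega

/-- The gap condition: leaving out `G = B ^ 2` levels separates the levels on the two sides by a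
factor `B + 1`. -/
theorem mul_level_le_level_add_sq {B : ℕ} (hB : 0 < B) (k : ℕ) :
    (B + 1) * level B k ≤ level B (k + (B ^ 2 + 1)) := by
  refine Nat.le_of_mul_le_mul_left ?_ hB
  calc B * ((B + 1) * level B k) ≤ (B + (B ^ 2 + 1)) * level B k := by
        nlinarith [Nat.zero_le (level B k)]
    _ ≤ _ := le_mul_level_add hB k _

/-! ### Partial solutions -/

/-- The prices `P` and the allocation `X` of the items from `s` on, with price levels below `a`;
the profit is essentially at least `val`. Prices of sold items stay below the `G` highest
levels. -/
structure IsPartial (n m : ℕ) (C : ℕ → ℕ) (v : ℕ → ℕ → ℕ) (B G a s val : ℕ) (P X : ℕ → ℕ) :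
    Prop where
  ladder : ∀ i j, s ≤ i → i ≤ j → j < n → P j ≤ P i
  top : ∀ i, s ≤ i → i < n → P i ≤ level B (a - 1)
  alloc : IsAlloc n m v C P X
  lower : ∀ b < m, ∀ i, X b = i + 1 → s ≤ i
  gap : ∀ b < m, ∀ i, X b = i + 1 → P i ≤ level B (a - 1 - G)
  val : B * val ≤ (B + 1) * ∑ b ∈ range m, pay P X b

theorem IsPartial.zero (n m : ℕ) (C : ℕ → ℕ) (v : ℕ → ℕ → ℕ) (B G a s : ℕ) :
    IsPartial n m C v B G a s 0 (fun _ => 0) (fun _ => 0) where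
  ladder _ _ _ _ _ := le_rfl
  top _ _ _ := Nat.zero_le _
  alloc := ⟨by simp, by simp, by simp [sold]⟩
  lower := by simp
  gap := by simp
  val := by simp

/-- Table rows and output arrays are controlled only at positions of actual items and bidders. -/
theorem IsPartial.congr {n m : ℕ} {C : ℕ → ℕ} {v : ℕ → ℕ → ℕ} {B G a s val : ℕ} {P X P' X' : ℕ → ℕ}
    (h : IsPartial n m C v B G a s val P X) (hP : ∀ i < n, P' i = P i) (hX : ∀ b < m, X' b = X b) :
    IsPartial n m C v B G a s val P' X' := by
  have key : ∀ b < m, ∀ i, X' b = i + 1 → X b = i + 1 ∧ P' i = P i := by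
    intro b hb i hi
    rw [hX b hb] at hi
    exact ⟨hi, hP i (by have := h.alloc.le b hb; omega)⟩
  refine ⟨?_, ?_, ⟨?_, ?_, ?_⟩, ?_, ?_, ?_⟩
  · intro i j h1 h2 h3
    rw [hP j h3, hP i (by omega)]
    exact h.ladder i j h1 h2 h3
  · intro i h1 h2
    rw [hP i h2]
    exact h.top i h1 h2
  · intro b hb
    rw [hX b hb]
    exact h.alloc.le b hb
  · intro b hb i hi
    rw [(key b hb i hi).2]
    exact h.alloc.afford b hb i (key b hb i hi).1
  · intro i hi
    refine le_trans (le_of_eq ?_) (h.alloc.supply i hi)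
    unfold sold
    congr 1
    exact filter_congr fun b hb => by rw [hX b (mem_range.mp hb)]
  · exact fun b hb i hi => h.lower b hb i (key b hb i hi).1
  · intro b hb i hi
    rw [(key b hb i hi).2]
    exact h.gap b hb i (key b hb i hi).1
  · refine h.val.trans (le_of_eq ?_)
    congr 1
    refine sum_congr rfl fun b hb => ?_
    have hb := mem_range.mp hb
    unfold pay
    rw [hX b hb]
    split_ifs with h0
    · rfl
    · rw [hP]
      have := h.alloc.le b hb
      omega

/-! ### Blocks of consecutive price levels -/

/-- The level of item `i`, counted from the highest level of the block, if the items are divided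
at the thresholds `d 1, …, d (K - 1)`. -/
def depth (K : ℕ) (d : ℕ → ℕ) (i : ℕ) : ℕ := ∑ l ∈ range (K - 1), (1 - (d (l + 1) - i))

/-- The price of item `i` in the block whose highest level is `a`. -/
def blockPrice (B K : ℕ) (d : ℕ → ℕ) (a i : ℕ) : ℕ := level B (a - depth K d i)

/-- The supply of item `i` in the block: the items outside the block and those at the `G` highest
levels are not sold. -/
def blockCap (C : ℕ → ℕ) (G K : ℕ) (d : ℕ → ℕ) (i : ℕ) : ℕ :=
  if d 0 ≤ i ∧ i < d K ∧ G ≤ depth K d i then C i else 0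

/-- The depth counts the thresholds not exceeding the item, so it is monotone even if the thresholds
are unsorted. The exhaustive search need not filter for sorted tuples. -/
theorem depth_mono (K : ℕ) (d : ℕ → ℕ) : Monotone (depth K d) :=
  fun _ _ h => sum_le_sum fun l _ => by omega

theorem depth_le (K : ℕ) (d : ℕ → ℕ) (i : ℕ) : depth K d i ≤ K - 1 := by
  calc depth K d i ≤ ∑ l ∈ range (K - 1), 1 := sum_le_sum fun l _ => by omega
    _ = K - 1 := by simp

theorem blockPrice_antitone (B K : ℕ) (d : ℕ → ℕ) (a : ℕ) : Antitone (blockPrice B K d a) :=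
  fun _ _ h => level_mono B (Nat.sub_le_sub_left (depth_mono K d h) a)

/-- Bidders served twice keep the item of the higher block. The price given up is at most 1/(B+1) of
the price kept, so it is paid for by counting only B/(B+1) of the latter. The older profit already
carries this factor in `val` and is not discounted again; hence the loss does not accumulate over
the blocks. -/
theorem IsPartial.extend {n m : ℕ} {C : ℕ → ℕ} {v : ℕ → ℕ → ℕ} {B G K a val : ℕ} {d P X y : ℕ → ℕ}
    (hK : 0 < K) (hG : ∀ k, (B + 1) * level B k ≤ level B (k + (G + 1)))
    (h : IsPartial n m C v B G (a + 1 - K) (d K) val P X) (hd : d 0 ≤ d K)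
    (hy : IsAlloc n m v (blockCap C G K d) (blockPrice B K d a) y) :
    IsPartial n m C v B G (a + 1) (d 0) (∑ b ∈ range m, pay (blockPrice B K d a) y b + val)
      (fun i => if i < d K then blockPrice B K d a i else P i)
      (fun b => if y b ≠ 0 then y b else X b) := by
  set pr := blockPrice B K d a with hpr
  have hpos : ∀ b < m, ∀ i, y b = i + 1 → d 0 ≤ i ∧ i < d K ∧ G ≤ depth K d i := by
    intro b hb i hi
    by_contra hcon
    have h1 := hy.supply i (by have := hy.le b hb; omega)
    rw [blockCap, if_neg hcon] at h1
    have h2 : b ∈ ({b ∈ range m | y b = i + 1} : Finset ℕ) := by simp [hb, hi]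
    have := card_pos.mpr ⟨b, h2⟩
    unfold sold at h1
    omega
  have hlow : ∀ i, level B (a + 1 - K) ≤ pr i := by
    intro i
    have := depth_le K d i
    exact level_mono B (by omega)
  have hy1 : ∀ b < m, ∀ i, (if y b ≠ 0 then y b else X b) = i + 1 →
      (y b = i + 1 ∧ d 0 ≤ i ∧ i < d K ∧ G ≤ depth K d i) ∨ (y b = 0 ∧ X b = i + 1 ∧ d K ≤ i) := by
    intro b hb i hi
    by_cases h0 : y b = 0
    · rw [if_neg (not_not.mpr h0)] at hi
      exact Or.inr ⟨h0, hi, h.lower b hb i hi⟩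
    · rw [if_pos h0] at hi
      exact Or.inl ⟨hi, hpos b hb i hi⟩
  refine ⟨?_, ?_, ⟨?_, ?_, ?_⟩, ?_, ?_, ?_⟩
  · intro i j h1 h2 h3
    by_cases hj : j < d K
    · simp only [hj, show i < d K by omega, if_true]
      exact blockPrice_antitone B K d a h2
    · by_cases hi : i < d K
      · simp only [hj, hi, if_true, if_false]
        exact (h.top j (by omega) h3).trans ((level_mono B (by omega)).trans (hlow i))
      · simp only [hj, hi, if_false]
        exact h.ladder i j (by omega) h2 h3
  · intro i h1 h2
    split_ifs with hi
    · exact level_mono B (by omega)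
    · exact (h.top i (by omega) h2).trans (level_mono B (by omega))
  · intro b hb
    split_ifs
    · exact hy.le b hb
    · exact h.alloc.le b hb
  · intro b hb i hi
    rcases hy1 b hb i hi with h1 | h1
    · rw [if_pos h1.2.2.1]
      exact hy.afford b hb i h1.1
    · rw [if_neg (by omega)]
      exact h.alloc.afford b hb i h1.2.1
  · intro i hi
    by_cases hiK : i < d K
    · calc sold m _ i ≤ sold m y i := by
            refine card_le_card fun b => ?_
            simp only [mem_filter, mem_range]
            rintro ⟨hb, hbi⟩
            rcases hy1 b hb i hbi with h1 | h1
            · exact ⟨hb, h1.1⟩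
            · omega
        _ ≤ blockCap C G K d i := hy.supply i hi
        _ ≤ C i := by unfold blockCap; split_ifs <;> omega
    · calc sold m _ i ≤ sold m X i := by
            refine card_le_card fun b => ?_
            simp only [mem_filter, mem_range]
            rintro ⟨hb, hbi⟩
            rcases hy1 b hb i hbi with h1 | h1
            · omega
            · exact ⟨hb, h1.2.1⟩
        _ ≤ C i := h.alloc.supply i hi
  · intro b hb i hi
    rcases hy1 b hb i hi with h1 | h1 <;> omega
  · intro b hb i hi
    rcases hy1 b hb i hi with h1 | h1
    · rw [if_pos h1.2.2.1]
      exact level_mono B (by omega)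
    · rw [if_neg (by omega)]
      exact (h.gap b hb i h1.2.1).trans (level_mono B (by omega))
  -- The charging argument, bidder by bidder; summing it and adding the old `val` gives the new one.
  · have hb : ∀ b ∈ range m, B * pay pr y b + (B + 1) * pay P X b ≤ (B + 1) *
        pay (fun i => if i < d K then pr i else P i) (fun b => if y b ≠ 0 then y b else X b) b := by
      intro b hb
      have hb := mem_range.mp hb
      by_cases h0 : y b = 0
      · have h1 : pay (fun i => if i < d K then pr i else P i)
            (fun b => if y b ≠ 0 then y b else X b) b = pay P X b := by
          simp only [pay, h0, ne_eq, not_true_eq_false, if_false]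
          split_ifs with h2 h3
          · rfl
          · have := h.lower b hb (X b - 1) (by omega)
            omega
          · rfl
        rw [h1]
        simp [pay, h0]
      · have h1 := hpos b hb (y b - 1) (by omega)
        have h2 : pay (fun i => if i < d K then pr i else P i)
            (fun b => if y b ≠ 0 then y b else X b) b = pr (y b - 1) := by
          simp [pay, h0, h1.2.1]
        have h3 : (B + 1) * pay P X b ≤ pr (y b - 1) := by
          by_cases hX0 : X b = 0
          · simp [pay, hX0]
          · have h4 : pay P X b ≤ level B (a + 1 - K - 1 - G) := by
              rw [pay, if_neg hX0]
              exact h.gap b hb _ (by omega)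
            -- If fewer than `G + 1` levels remain below the block, the gap forces all lower sales
            -- to price 0; otherwise `hG` supplies the factor.
            by_cases ha : a + 1 - K ≤ G
            · rw [show a + 1 - K - 1 - G = 0 by omega, level] at h4
              simp [Nat.le_zero.mp h4]
            · calc (B + 1) * pay P X b ≤ (B + 1) * level B (a + 1 - K - 1 - G) :=
                    Nat.mul_le_mul_left _ h4
                _ ≤ level B (a + 1 - K - 1 - G + (G + 1)) := hG _
                _ ≤ pr (y b - 1) := (level_mono B (by omega)).trans (hlow _)
        rw [h2]
        have h5 : pay pr y b = pr (y b - 1) := by simp [pay, h0]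
        rw [h5]
        linarith
    have h6 := sum_le_sum hb
    rw [sum_add_distrib, ← mul_sum, ← mul_sum, ← mul_sum] at h6
    have := h.val
    linarith

/-! ### Comparison with an arbitrary solution -/

/-- The price ladder enters here: the items at or above a given level form an initial segment, so a
single number describes them. -/
theorem exists_threshold (n : ℕ) (lv : ℕ → ℕ) (hlv : ∀ i j, i ≤ j → j < n → lv j ≤ lv i) (a : ℕ) :
    ∃ t ≤ n, ∀ i < n, (i < t ↔ a ≤ lv i) := by
  induction n with
  | zero => exact ⟨0, le_rfl, by simp⟩
  | succ n ih =>
    obtain ⟨t, ht, h⟩ := ih fun i j h1 h2 => hlv i j h1 (by omega)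
    by_cases hn : a ≤ lv n
    · refine ⟨n + 1, le_rfl, fun i hi => ?_⟩
      have := hlv i n (by omega) (by omega)
      exact ⟨fun _ => by omega, fun _ => hi⟩
    · refine ⟨t, by omega, fun i hi => ?_⟩
      rcases Nat.lt_succ_iff_lt_or_eq.mp hi with h1 | rfl
      · exact h i h1
      · exact ⟨fun _ => by omega, fun _ => by omega⟩

/-- The part of the profit from items at levels below `a`, apart from the `G` highest levels of
each of the blocks of `K` levels that lie below `a`. -/
def blockProfit (B G K m : ℕ) (lv x : ℕ → ℕ) (a : ℕ) : ℕ :=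
  ∑ b ∈ range m, if x b ≠ 0 ∧ lv (x b - 1) < a ∧ G ≤ (a - 1 - lv (x b - 1)) % K
    then level B (lv (x b - 1)) else 0

/-- For the thresholds of an actual level assignment, the thresholds passed by an item correspond to
the levels between its own and the top of the block. -/
theorem depth_eq {n K a : ℕ} {lv d : ℕ → ℕ}
    (hd : ∀ l ≤ K, ∀ i < n, (i < d l ↔ a + 1 - l ≤ lv i)) {i : ℕ} (hi : i < n)
    (h1 : lv i ≤ a) (h2 : a + 1 - K ≤ lv i) (hK : 0 < K) : depth K d i = a - lv i := by
  have h : ∀ l ∈ range (K - 1), 1 - (d (l + 1) - i) = if l < a - lv i then 1 else 0 := by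
    intro l hl
    rw [mem_range] at hl
    have := hd (l + 1) (by omega) i hi
    split_ifs with h3 <;> omega
  rw [depth, sum_congr rfl h, ← sum_filter, sum_const, smul_eq_mul, mul_one]
  have : {l ∈ range (K - 1) | l < a - lv i} = range (a - lv i) := by
    ext l
    simp only [mem_filter, mem_range]
    omega
  rw [this, card_range]

/-- The completeness half of the dynamic program. The given solution induces thresholds and,
restricted to the sellable items of the top block, an allocation admitted by `hD`; what lies below
the block is handled by induction. The factor 2 is that of the greedy allocation in each block. -/
theorem blockProfit_le {n m : ℕ} {C : ℕ → ℕ} {v : ℕ → ℕ → ℕ} {B G K A : ℕ} {D : ℕ → ℕ → ℕ}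
    (hK : 0 < K)
    (hD : ∀ a < A, ∀ d : ℕ → ℕ, (∀ l ≤ K, d l ≤ n) → d 0 ≤ d K → ∀ x,
      IsAlloc n m v (blockCap C G K d) (blockPrice B K d a) x →
      ∑ b ∈ range m, pay (blockPrice B K d a) x b + 2 * D (a + 1 - K) (d K) ≤
        2 * D (a + 1) (d 0))
    {lv x : ℕ → ℕ} (hlv : ∀ i j, i ≤ j → j < n → lv j ≤ lv i)
    (hx : IsAlloc n m v C (fun i => level B (lv i)) x) {a t : ℕ} (ha : a ≤ A) (htn : t ≤ n)
    (ht : ∀ i < n, (i < t ↔ a ≤ lv i)) :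
    blockProfit B G K m lv x a ≤ 2 * D a t := by
  induction a using Nat.strong_induction_on generalizing t with
  | _ a ih =>
    rcases a with _ | a
    · simp [blockProfit]
    choose th hth1 hth2 using exists_threshold n lv hlv
    -- The `l`-th threshold separates the items at the `l` highest levels of the block, or above the
    -- block, from the rest. For `l = 0` the given `t` is used, so that the table entry is the one
    -- in the goal.
    set d : ℕ → ℕ := fun l => if l = 0 then t else th (a + 1 - l) with hdd
    have hdn : ∀ l ≤ K, d l ≤ n := by
      intro l _
      simp only [hdd]
      split_ifs
      · exact htn
      · exact hth1 _
    have hd : ∀ l ≤ K, ∀ i < n, (i < d l ↔ a + 1 - l ≤ lv i) := by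
      intro l _ i hi
      simp only [hdd]
      split_ifs with h
      · rw [h]
        exact ht i hi
      · exact hth2 _ i hi
    have h0K : d 0 ≤ d K := by
      by_contra hcon
      have h1 := hd 0 (by omega) (d K) (by have := hdn 0 (by omega); omega)
      have h2 := hd K le_rfl (d K) (by have := hdn 0 (by omega); omega)
      omega
    set x' : ℕ → ℕ := fun b => if b < m ∧ x b ≠ 0 ∧ lv (x b - 1) < a + 1 ∧
      a + 1 - K ≤ lv (x b - 1) ∧ G ≤ a - lv (x b - 1) then x b else 0 with hx'
    have hx'1 : ∀ b i, x' b = i + 1 → b < m ∧ x b = i + 1 ∧ i < n ∧ lv i ≤ a ∧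
        a + 1 - K ≤ lv i ∧ G ≤ a - lv i := by
      intro b i hb
      simp only [hx'] at hb
      split_ifs at hb with h
      have := hx.le b h.1
      rw [hb, Nat.add_sub_cancel] at h
      refine ⟨h.1, hb, by omega, by omega, by omega, by omega⟩
    have hprice : ∀ b i, x' b = i + 1 → blockPrice B K d a i = level B (lv i) := by
      intro b i hb
      obtain ⟨-, -, h1, h2, h3, -⟩ := hx'1 b i hb
      rw [blockPrice, depth_eq hd h1 h2 h3 hK]
      congr 1
      omega
    have halloc : IsAlloc n m v (blockCap C G K d) (blockPrice B K d a) x' := by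
      refine ⟨?_, ?_, ?_⟩
      · intro b hb
        simp only [hx']
        split_ifs
        · exact hx.le b hb
        · omega
      · intro b hb i hi
        rw [hprice b i hi]
        exact hx.afford b hb i (hx'1 b i hi).2.1
      · intro i hi
        by_cases hne : ∃ b, x' b = i + 1
        · obtain ⟨b, hb⟩ := hne
          obtain ⟨-, -, -, h2, h3, h4⟩ := hx'1 b i hb
          have h5 : blockCap C G K d i = C i := by
            rw [blockCap, if_pos]
            rw [depth_eq hd hi h2 h3 hK]
            have := hd 0 (by omega) i hi
            have := hd K le_rfl i hi
            omega
          rw [h5]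
          refine le_trans (card_le_card fun b => ?_) (hx.supply i hi)
          simp only [mem_filter, mem_range]
          exact fun hb => ⟨hb.1, (hx'1 b i hb.2).2.1⟩
        · push Not at hne
          simp [sold, hne]
    have hrec := hD a (by omega) d hdn h0K x' halloc
    have hprev := ih (a + 1 - K) (by omega) (t := d K) (by omega) (hdn K le_rfl) (hd K le_rfl)
    have hsum : blockProfit B G K m lv x (a + 1) ≤
        ∑ b ∈ range m, pay (blockPrice B K d a) x' b + blockProfit B G K m lv x (a + 1 - K) := by
      unfold blockProfit
      rw [← sum_add_distrib]
      refine sum_le_sum fun b hb => ?_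
      have hb := mem_range.mp hb
      split_ifs with h1 h2 h2
      · omega
      · obtain ⟨h3, h4, h5⟩ := h1
        -- A level below the block keeps its residue mod `K` when the top moves down by `K`, so it
        -- would be counted in the second summand.
        have h6 : a + 1 - K ≤ lv (x b - 1) := by
          by_contra hcon
          refine h2 ⟨h3, by omega, ?_⟩
          rw [show a + 1 - 1 - lv (x b - 1) = a + 1 - K - 1 - lv (x b - 1) + K by omega,
            Nat.add_mod_right] at h5
          exact h5
        rw [Nat.mod_eq_of_lt (by omega)] at h5
        have h7 : x' b = x b := by
          simp only [hx']
          rw [if_pos]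
          exact ⟨hb, h3, h4, h6, by omega⟩
        rw [pay, h7, if_neg h3, hprice b (x b - 1) (by omega)]
        omega
      · omega
      · omega
    have hd0 : d 0 = t := by simp [hdd]
    rw [hd0] at hrec
    omega

/-- As the cuts move through `K` consecutive positions, a level takes each place within its block
exactly once and is suppressed in `G` of them. -/
theorem card_window (G K k L : ℕ) (hk : k ≤ L) :
    #{a ∈ Ioc L (L + K) | k < a ∧ G ≤ (a - 1 - k) % K} = K - G := by
  have h1 : #{a ∈ Ioc L (L + K) | k < a ∧ G ≤ (a - 1 - k) % K} =
      #{e ∈ Ico (L - k) (L - k + K) | G ≤ e % K} := by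
    refine card_bij' (fun a _ => a - 1 - k) (fun e _ => e + 1 + k) ?_ ?_ ?_ ?_
    · intro a ha
      simp only [mem_filter, mem_Ioc, mem_Ico] at ha ⊢
      exact ⟨by omega, ha.2.2⟩
    · intro e he
      simp only [mem_filter, mem_Ioc, mem_Ico] at he ⊢
      refine ⟨by omega, by omega, ?_⟩
      rw [show e + 1 + k - 1 - k = e by omega]
      exact he.2
    · intro a ha
      simp only [mem_filter, mem_Ioc] at ha
      omega
    · intro e he
      simp only [mem_filter, mem_Ico] at he
      omega
  have hper : Function.Periodic (fun e => G ≤ e % K) K := fun e => by simp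
  rw [h1, Nat.filter_Ico_card_eq_of_periodic _ _ _ hper, Nat.count_eq_card_filter_range]
  have : {e ∈ range K | G ≤ e % K} = Ico G K := by
    ext e
    simp only [mem_filter, mem_range, mem_Ico]
    constructor
    · rintro ⟨h, h'⟩
      rw [Nat.mod_eq_of_lt h] at h'
      exact ⟨h', h⟩
    · rintro ⟨h, h'⟩
      rw [Nat.mod_eq_of_lt h']
      exact ⟨h', h⟩
  rw [this, Nat.card_Ico]

/-- The shifting argument. Starting positions range over the `K` values just above the top level
`L`, so every level in use lies below each of them and the first threshold is 0. -/
theorem sub_mul_sum_pay_le {n m : ℕ} {C : ℕ → ℕ} {v : ℕ → ℕ → ℕ} {B G K L best : ℕ}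
    {D : ℕ → ℕ → ℕ} (hK : 0 < K)
    (hD : ∀ a < L + K, ∀ d : ℕ → ℕ, (∀ l ≤ K, d l ≤ n) → d 0 ≤ d K → ∀ x,
      IsAlloc n m v (blockCap C G K d) (blockPrice B K d a) x →
      ∑ b ∈ range m, pay (blockPrice B K d a) x b + 2 * D (a + 1 - K) (d K) ≤
        2 * D (a + 1) (d 0))
    (hbest : ∀ a, 0 < a → a ≤ L + K → D a 0 ≤ best)
    {lv x : ℕ → ℕ} (hlv : ∀ i j, i ≤ j → j < n → lv j ≤ lv i) (hL : ∀ i < n, lv i ≤ L)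
    (hx : IsAlloc n m v C (fun i => level B (lv i)) x) :
    (K - G) * ∑ b ∈ range m, pay (fun i => level B (lv i)) x b ≤ K * (2 * best) := by
  have h1 : ∑ a ∈ Ioc L (L + K), blockProfit B G K m lv x a ≤ K * (2 * best) := by
    calc ∑ a ∈ Ioc L (L + K), blockProfit B G K m lv x a
        ≤ ∑ a ∈ Ioc L (L + K), 2 * best := by
          refine sum_le_sum fun a ha => ?_
          rw [mem_Ioc] at ha
          have h := blockProfit_le hK hD hlv hx (a := a) (t := 0) ha.2 (Nat.zero_le _) (by
            intro i hi
            have := hL i hi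
            omega)
          have := hbest a (by omega) ha.2
          omega
      _ = K * (2 * best) := by simp
  refine le_trans (le_of_eq ?_) h1
  unfold blockProfit
  rw [sum_comm, mul_sum]
  refine sum_congr rfl fun b hb => ?_
  have hb := mem_range.mp hb
  by_cases h0 : x b = 0
  · simp [pay, h0]
  · simp only [ne_eq, h0, not_false_eq_true, true_and, pay, if_false]
    rw [← sum_filter, sum_const, smul_eq_mul, card_window]
    exact hL _ (by have := hx.le b hb; omega)

/-! ### The greedy allocation of a block -/

/-- The state of the greedy algorithm after offering the first `k` items. -/
structure IsGreedy (m : ℕ) (v : ℕ → ℕ → ℕ) (cap P : ℕ → ℕ) (k : ℕ) (y : ℕ → ℕ) : Prop where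
  le : ∀ b < m, y b ≤ k
  afford : ∀ b < m, ∀ i, y b = i + 1 → P i ≤ v i b
  supply : ∀ i < k, sold m y i ≤ cap i
  stable : ∀ i < k, ∀ b < m, P i ≤ v i b → (0 < y b ∧ y b ≤ i + 1) ∨ cap i ≤ sold m y i

/-- Offering a new item moves only unserved bidders, so the sales of earlier items are final. -/
theorem IsGreedy.sold_eq {m k i : ℕ} {y y' : ℕ → ℕ} (hi : i < k)
    (h : ∀ b < m, y' b = y b ∨ (y b = 0 ∧ y' b = k + 1)) : sold m y' i = sold m y i := by
  unfold sold
  congr 1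
  refine filter_congr fun b hb => ?_
  rcases h b (mem_range.mp hb) with h1 | h1 <;> omega

theorem IsGreedy.succ {m k : ℕ} {v : ℕ → ℕ → ℕ} {cap P y y' : ℕ → ℕ}
    (h : IsGreedy m v cap P k y)
    (h1 : ∀ b < m, y' b = y b ∨ (y b = 0 ∧ y' b = k + 1 ∧ P k ≤ v k b))
    (h2 : sold m y' k ≤ cap k)
    (h3 : ∀ b < m, P k ≤ v k b → y' b ≠ 0 ∨ cap k ≤ sold m y' k) :
    IsGreedy m v cap P (k + 1) y' := by
  have h1' : ∀ b < m, y' b = y b ∨ (y b = 0 ∧ y' b = k + 1) :=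
    fun b hb => (h1 b hb).imp_right fun h => ⟨h.1, h.2.1⟩
  have hle : ∀ b < m, y' b ≤ k + 1 := by
    intro b hb
    have := h.le b hb
    rcases h1 b hb with h4 | h4 <;> omega
  refine ⟨hle, ?_, ?_, ?_⟩
  · intro b hb i hi
    rcases h1 b hb with h4 | h4
    · exact h.afford b hb i (by omega)
    · rw [show i = k by omega]
      exact h4.2.2
  · intro i hi
    rcases Nat.lt_succ_iff_lt_or_eq.mp hi with hik | rfl
    · rw [IsGreedy.sold_eq hik h1']
      exact h.supply i hik
    · exact h2
  · intro i hi b hb hv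
    rcases Nat.lt_succ_iff_lt_or_eq.mp hi with hik | rfl
    · rw [IsGreedy.sold_eq hik h1']
      refine (h.stable i hik b hb hv).imp_left fun h4 => ?_
      rcases h1 b hb with h5 | h5 <;> omega
    · refine (h3 b hb hv).imp_left fun h4 => ?_
      have := hle b hb
      omega

/-! ### The greedy allocation as a machine program -/

/-- The number of thresholds at positions `1, …, k` that do not exceed the item. -/
def depthExpr : ℕ → Expr
  | 0 => 0
  | k + 1 => depthExpr k + (1 - (.var (100 + (k + 1)) - .var 21))

/-- The thresholds in memory. -/
def thresholds (σ : Mem) (l : ℕ) : ℕ := σ (100 + l) 0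

theorem eval_depthExpr (K : ℕ) (σ : Mem) :
    (depthExpr (K - 1)).eval σ = depth K (thresholds σ) (σ 21 0) := by
  unfold depth
  generalize K - 1 = k
  induction k with
  | zero => rfl
  | succ k ih => rw [sum_range_succ, ← ih]; rfl

/-- Bidder `σ 22 0` gets a copy of item `σ 21 0` if possible. -/
def sell : BProg :=
  .ite ((1 - .read 14 (.var 22)) * .var 16 *
      (1 - (.read 12 (.var 21) - .read 2 (.var 21 * .read 6 1 + .var 22))))
    (.seq (.write 14 (.var 22) (.var 21 + 1))
      (.seq (.write 16 0 (.var 16 - 1)) (.write 15 0 (.var 15 + .read 12 (.var 21)))))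
    .skip

theorem sold_succ (β : ℕ) (X : ℕ → ℕ) (i : ℕ) :
    sold (β + 1) X i = sold β X i + if X β = i + 1 then 1 else 0 := by
  unfold sold
  rw [range_add_one, filter_insert]
  split_ifs with h
  · rw [card_insert_of_notMem (by simp)]
  · rfl

theorem sold_congr {β : ℕ} {X Y : ℕ → ℕ} (h : ∀ b < β, X b = Y b) (i : ℕ) :
    sold β X i = sold β Y i := by
  unfold sold
  congr 1
  exact filter_congr fun b hb => by rw [h b (mem_range.mp hb)]

/-- Arrays 12, 14, 15 and 16 hold prices, allocation, profit and remaining copies; 21 and 22 hold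
the current item and bidder. The invariant keeps copies sold plus copies left constant. As the
remaining supply never increases, a bidder refused for lack of copies witnesses that the item ends
sold out. -/
theorem exec_sell {m i : ℕ} {v : ℕ → ℕ} (σ : Mem) (hm : σ 6 1 = m) (hi : σ 21 0 = i)
    (hv : ∀ b < m, σ 2 (i * m + b) = v b) (hy : ∀ b < m, σ 14 b ≤ i) :
    (∀ b < m, (BProg.iter 22 1 sell).exec σ 14 b = σ 14 b ∨
      (σ 14 b = 0 ∧ (BProg.iter 22 1 sell).exec σ 14 b = i + 1 ∧ σ 12 i ≤ v b)) ∧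
    sold m ((BProg.iter 22 1 sell).exec σ 14) i + (BProg.iter 22 1 sell).exec σ 16 0 = σ 16 0 ∧
    (BProg.iter 22 1 sell).exec σ 15 0 =
      σ 15 0 + σ 12 i * sold m ((BProg.iter 22 1 sell).exec σ 14) i ∧
    ∀ b < m, σ 12 i ≤ v b →
      (BProg.iter 22 1 sell).exec σ 14 b ≠ 0 ∨ (BProg.iter 22 1 sell).exec σ 16 0 = 0 := by
  have h := BProg.exec_iter (i := 22) (p := 1) (c := sell) (σ := σ) (N := m)
    (fun β τ => (τ 6 = σ 6 ∧ τ 21 = σ 21 ∧ τ 2 = σ 2 ∧ τ 12 = σ 12) ∧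
      (∀ b, β ≤ b → τ 14 b = σ 14 b) ∧
      (∀ b < β, τ 14 b = σ 14 b ∨ (σ 14 b = 0 ∧ τ 14 b = i + 1 ∧ σ 12 i ≤ v b)) ∧
      sold β (τ 14) i + τ 16 0 = σ 16 0 ∧
      τ 15 0 = σ 15 0 + σ 12 i * sold β (τ 14) i ∧
      ∀ b < β, σ 12 i ≤ v b → τ 14 b ≠ 0 ∨ τ 16 0 = 0) hm
    (by simp [Mem.set_row_of_ne, sold]) ?_
  · exact ⟨h.2.2.1, h.2.2.2⟩
  rintro β τ hβ hcnt ⟨⟨e6, e21, e2, e12⟩, h1, h2, h3, h4, h5⟩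
  have hβ14 := h1 β le_rfl
  have hcond : ((1 - .read 14 (.var 22)) * .var 16 *
      (1 - (.read 12 (.var 21) - .read 2 (.var 21 * .read 6 1 + .var 22))) : Expr).eval τ ≠ 0 ↔
      τ 14 β = 0 ∧ τ 16 0 ≠ 0 ∧ σ 12 i ≤ v β := by
    simp only [Expr.eval_mul, Expr.eval_sub, Expr.eval_add, Expr.eval_read, Expr.eval_var,
      Expr.eval_one, hcnt, e6, e21, e2, e12, hi, hm, hv β hβ, ne_eq, mul_eq_zero, not_or]
    omega
  by_cases hc : τ 14 β = 0 ∧ τ 16 0 ≠ 0 ∧ σ 12 i ≤ v β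
  · have hex : ((sell.exec τ).set 22 0 (β + 1)) =
        ((((τ.set 14 β (i + 1)).set 16 0 (τ 16 0 - 1)).set 15 0 (τ 15 0 + σ 12 i)).set 22 0
          (β + 1)) := by
      rw [sell, BProg.exec, if_pos (hcond.mpr hc)]
      simp [BProg.exec, Mem.set_row_of_ne, hcnt, e21, hi, e12]
    rw [hex]
    have s : sold β (fun b => if b = β then i + 1 else τ 14 b) i = sold β (τ 14) i :=
      sold_congr (fun b hb => by simp [hb.ne]) i
    have r14 : ((((τ.set 14 β (i + 1)).set 16 0 (τ 16 0 - 1)).set 15 0 (τ 15 0 + σ 12 i)).set 22 0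
          (β + 1)) 14 = fun b => if b = β then i + 1 else τ 14 b := by
      funext b
      simp [Mem.set_row_of_ne, Mem.set_apply_same_row]
    rw [r14, sold_succ, s]
    refine ⟨by simp [Mem.set_row_of_ne, *], ?_, ?_, ?_, ?_, ?_⟩
    · intro b hb
      dsimp only
      rw [if_neg (by omega)]
      exact h1 b (by omega)
    · intro b hb
      dsimp only
      split_ifs with hbβ
      · subst hbβ
        exact Or.inr ⟨by omega, rfl, hc.2.2⟩
      · exact h2 b (by omega)
    · simp [Mem.set_row_of_ne, Mem.set_apply_same_row]
      omega
    · simp [Mem.set_row_of_ne, Mem.set_apply_same_row, h4]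
      ring
    · intro b hb hvb
      dsimp only
      split_ifs with hbβ
      · simp
      · have := h5 b (by omega) hvb
        simp [Mem.set_row_of_ne, Mem.set_apply_same_row]
        omega
  · have hex : ((sell.exec τ).set 22 0 (β + 1)) = τ.set 22 0 (β + 1) := by
      rw [sell, BProg.exec, if_neg (fun h => hc (hcond.mp h))]
      rfl
    rw [hex]
    -- Before its turn a bidder's entry refers to an earlier item, so a refused bidder is not
    -- counted as a sale of item `i`.
    have hne : τ 14 β ≠ i + 1 := by have := hy β hβ; omega
    have r (a) (ha : a ≠ 22) : τ.set 22 0 (β + 1) a = τ a := Mem.set_row_of_ne ha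
    rw [r 6 (by simp), r 21 (by simp), r 2 (by simp), r 12 (by simp), r 14 (by simp),
      r 15 (by simp), r 16 (by simp), sold_succ, if_neg hne, add_zero]
    refine ⟨⟨e6, e21, e2, e12⟩, fun b hb => h1 b (by omega), ?_, h3, h4, ?_⟩
    · intro b hb
      rcases Nat.lt_succ_iff_lt_or_eq.mp hb with h6 | rfl
      · exact h2 b h6
      · exact Or.inl hβ14
    · intro b hb hvb
      rcases Nat.lt_succ_iff_lt_or_eq.mp hb with h6 | rfl
      · exact h5 b h6 hvb
      · by_contra hcon
        push Not at hcon
        exact hc ⟨by omega, hcon.2, hvb⟩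

/-- A loop that fills a section of the array `arr`. -/
theorem exec_fill {i p arr N base : ℕ} {e f : Expr} {val : ℕ → ℕ} (σ : Mem) (hai : arr ≠ i)
    (hN : σ bnd p = N)
    (hf : ∀ τ : Mem, ∀ k < N, τ i 0 = k → (∀ a, a ≠ arr → a ≠ i → τ a = σ a) →
      (∀ x, x < base ∨ base + N ≤ x → τ arr x = σ arr x) →
      e.eval τ = base + k ∧ f.eval τ = val k) :
    (∀ k < N, (BProg.iter i p (.write arr e f)).exec σ arr (base + k) = val k) ∧
      ∀ x, x < base ∨ base + N ≤ x →
        (BProg.iter i p (.write arr e f)).exec σ arr x = σ arr x := by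
  have h := BProg.exec_iter (i := i) (p := p) (c := .write arr e f) (σ := σ) (N := N)
    (fun k τ => (∀ a, a ≠ arr → a ≠ i → τ a = σ a) ∧
      (∀ j < k, τ arr (base + j) = val j) ∧
      (∀ x, x < base ∨ base + N ≤ x → τ arr x = σ arr x)) hN
    ⟨fun a _ h => Mem.set_row_of_ne h, by simp, by simp [Mem.set_row_of_ne hai]⟩ ?_
  · exact h.2
  rintro k τ hk hcnt ⟨h1, h2, h3⟩
  obtain ⟨he, hv⟩ := hf τ k hk hcnt h1 h3
  rw [BProg.exec, he, hv]
  refine ⟨?_, ?_, ?_⟩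
  · intro a ha hi
    rw [Mem.set_row_of_ne hi, Mem.set_row_of_ne ha, h1 a ha hi]
  · intro j hj
    rw [Mem.set_row_of_ne hai, Mem.set_apply_same_row]
    split_ifs with h4
    · rw [show j = k by omega]
    · exact h2 j (by omega)
  · intro x hx
    rw [Mem.set_row_of_ne hai, Mem.set_apply_same_row, if_neg (by omega)]
    exact h3 x hx

/-- The memory holds the instance, the loop bounds and the price levels. -/
structure Holds (n m A B : ℕ) (C : ℕ → ℕ) (v : ℕ → ℕ → ℕ) (σ : Mem) : Prop where
  items : σ 6 0 = n
  bidders : σ 6 1 = m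
  thresholds : σ 6 2 = n + 1
  rounds : σ 6 3 = A
  copies : ∀ i < n, σ 1 i = C i
  value : ∀ i < n, ∀ b < m, σ 2 (i * m + b) = v i b
  levels : ∀ k < A, σ 7 k = level B k

theorem Holds.congr {n m A B : ℕ} {C : ℕ → ℕ} {v : ℕ → ℕ → ℕ} {σ τ : Mem}
    (h : Holds n m A B C v σ) (h1 : τ 1 = σ 1) (h2 : τ 2 = σ 2) (h6 : τ 6 = σ 6) (h7 : τ 7 = σ 7) :
    Holds n m A B C v τ := by
  constructor
  · rw [h6]; exact h.items
  · rw [h6]; exact h.bidders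
  · rw [h6]; exact h.thresholds
  · rw [h6]; exact h.rounds
  · rw [h1]; exact h.copies
  · rw [h2]; exact h.value
  · rw [h7]; exact h.levels

def priceExpr (K : ℕ) : Expr := .read 7 (.var 20 - depthExpr (K - 1))

/-- The divisor is a product of 0/1 tests; division by zero gives 0, so the quotient is a
conditional. Having the product in the divisor keeps the expression additive. -/
def capExpr (G K : ℕ) : Expr :=
  .read 1 (.var 21) / ((1 - (.var 100 - .var 21)) * (1 - (.var 21 + 1 - .var (100 + K))) *
    (1 - (.const G - depthExpr (K - 1))))

/-- The greedy allocation of the block with highest level `σ 20 0` and the given thresholds: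
array `12` receives the prices, array `14` the allocation, and array `15` the profit. -/
def greedy (G K : ℕ) : BProg :=
  .seq (.write 15 0 0) (.seq (.iter 22 1 (.write 14 (.var 22) 0))
    (.iter 21 0 (.seq (.write 12 (.var 21) (priceExpr K))
      (.seq (.write 16 0 (capExpr G K)) (.iter 22 1 sell)))))

theorem eval_capExpr (G K : ℕ) (C : ℕ → ℕ) (σ : Mem) {i : ℕ} (hi : σ 21 0 = i)
    (hC : σ 1 i = C i) : (capExpr G K).eval σ = blockCap C G K (thresholds σ) i := by
  simp only [capExpr, Expr.eval_div, Expr.eval_read, Expr.eval_var, Expr.eval_mul, Expr.eval_sub,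
    Expr.eval_add, Expr.eval_one, Expr.eval_const, eval_depthExpr, hi, hC, blockCap]
  have e0 : σ 100 0 = thresholds σ 0 := rfl
  have eK : σ (100 + K) 0 = thresholds σ K := rfl
  rw [e0, eK]
  split_ifs with h
  · rw [show 1 - (thresholds σ 0 - i) = 1 by omega, show 1 - (i + 1 - thresholds σ K) = 1 by omega,
      show 1 - (G - depth K (thresholds σ) i) = 1 by omega]
    simp
  · have : (1 - (thresholds σ 0 - i)) * (1 - (i + 1 - thresholds σ K)) *
        (1 - (G - depth K (thresholds σ) i)) = 0 := by
      rw [Nat.mul_eq_zero, Nat.mul_eq_zero]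
      omega
    rw [this, Nat.div_zero]

/-- Items are offered in index order, which is the order of nonincreasing prices; stability of the
result then yields the factor 2. The accumulated profit is tracked item by item and regrouped by
bidder at the end. -/
theorem exec_greedy {n m A B G K : ℕ} {C : ℕ → ℕ} {v : ℕ → ℕ → ℕ} (σ : Mem)
    (hσ : Holds n m A B C v σ) {a : ℕ} (ha : σ 20 0 = a) (haA : a < A) :
    (∀ i < n, (greedy G K).exec σ 12 i = blockPrice B K (thresholds σ) a i) ∧
    IsGreedy m v (blockCap C G K (thresholds σ)) (blockPrice B K (thresholds σ) a) n
      ((greedy G K).exec σ 14) ∧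
    (greedy G K).exec σ 15 0 =
      ∑ b ∈ range m, pay (blockPrice B K (thresholds σ) a) ((greedy G K).exec σ 14) b := by
  set d := thresholds σ with hd
  set pr := blockPrice B K d a with hpr
  set cap := blockCap C G K d with hcap
  set σ₁ := (BProg.iter 22 1 (.write 14 (.var 22) 0)).exec (σ.set 15 0 0) with hσ₁
  have hrow : ∀ a, a ≠ 22 → a ≠ 14 → a ≠ 15 → σ₁ a = σ a := by
    intro a h1 h2 h3
    rw [hσ₁, BProg.exec_row (by simp [BProg.Writes, h1, h2]), Mem.set_row_of_ne h3]
  have h14 : ∀ b < m, σ₁ 14 b = 0 := by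
    have h := (exec_fill (i := 22) (p := 1) (arr := 14) (N := m) (base := 0) (e := .var 22) (f := 0)
      (val := fun _ => 0) (σ.set 15 0 0) (by simp) (by simpa [Mem.set_row_of_ne] using hσ.bidders)
      (fun τ k _ h _ _ => by simpa using h)).1
    simpa using h
  have h15 : σ₁ 15 0 = 0 := by
    rw [hσ₁, BProg.exec_row (by simp [BProg.Writes])]
    simp [Mem.set]
  have h := BProg.exec_iter (i := 21) (p := 0) (c := .seq (.write 12 (.var 21) (priceExpr K))
      (.seq (.write 16 0 (capExpr G K)) (.iter 22 1 sell))) (σ := σ₁) (N := n)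
    (fun k τ => (∀ a, a ≠ 22 → a ≠ 21 → a ≠ 12 → a ≠ 14 → a ≠ 15 → a ≠ 16 → τ a = σ a) ∧
      (∀ i < k, τ 12 i = pr i) ∧ IsGreedy m v cap pr k (τ 14) ∧
      τ 15 0 = ∑ i ∈ range k, pr i * sold m (τ 14) i)
    (by rw [hrow 6 (by simp) (by simp) (by simp)]; exact hσ.items) ?_ ?_
  · refine ⟨h.2.1, h.2.2.1, h.2.2.2.trans ?_⟩
    rw [← sum_eq_sum_sold h.2.2.1.le]
    rfl
  · have e14 : (σ₁.set 21 0 0) 14 = σ₁ 14 := Mem.set_row_of_ne (by simp)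
    have e15 : (σ₁.set 21 0 0) 15 = σ₁ 15 := Mem.set_row_of_ne (by simp)
    refine ⟨?_, by simp, ?_, by rw [e15, h15]; rfl⟩
    · intro a h1 h2 h3 h4 h5 h6
      rw [Mem.set_row_of_ne h2, hrow a h1 h4 h5]
    · rw [e14]
      refine ⟨fun b hb => (h14 b hb).le, ?_, by simp, by simp⟩
      intro b hb i hi
      rw [h14 b hb] at hi
      omega
  · rintro k τ hk hcnt ⟨hτ, h1, h2, h3⟩
    have hpk : (priceExpr K).eval τ = pr k := by
      simp only [priceExpr, Expr.eval_read, Expr.eval_sub, Expr.eval_var, eval_depthExpr]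
      have hthr : thresholds τ = d := by
        funext l
        unfold thresholds
        rw [hτ _ (by omega) (by omega) (by omega) (by omega) (by omega) (by omega)]
        rfl
      rw [hthr, hτ 20 (by simp) (by simp) (by simp) (by simp) (by simp) (by simp),
        hτ 7 (by simp) (by simp) (by simp) (by simp) (by simp) (by simp), ha, hcnt,
        hσ.levels _ (by omega)]
      rfl
    set τ₁ := τ.set 12 k (pr k) with hτ₁
    have hck : (capExpr G K).eval τ₁ = cap k := by
      have hthr : thresholds τ₁ = d := by
        funext l
        unfold thresholds
        rw [hτ₁, Mem.set_row_of_ne (by omega),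
          hτ _ (by omega) (by omega) (by omega) (by omega) (by omega) (by omega)]
        rfl
      rw [eval_capExpr G K C τ₁ (i := k), hthr]
      · rw [hτ₁, Mem.set_row_of_ne (by simp), hcnt]
      · rw [hτ₁, Mem.set_row_of_ne (by simp),
          hτ 1 (by simp) (by simp) (by simp) (by simp) (by simp) (by simp)]
        exact hσ.copies k hk
    set τ₂ := τ₁.set 16 0 (cap k) with hτ₂
    have hex : BProg.exec (.seq (.write 12 (.var 21) (priceExpr K))
      (.seq (.write 16 0 (capExpr G K)) (.iter 22 1 sell))) τ =
        (BProg.iter 22 1 sell).exec τ₂ := by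
      simp only [BProg.exec, hpk, Expr.eval_var, hcnt, ← hτ₁, hck, Expr.eval_zero, ← hτ₂]
    rw [hex]
    have hr₂ : ∀ a, a ≠ 12 → a ≠ 16 → τ₂ a = τ a := by
      intro a h1 h2
      rw [hτ₂, Mem.set_row_of_ne h2, hτ₁, Mem.set_row_of_ne h1]
    have h12 : τ₂ 12 = fun x => if x = k then pr k else τ 12 x := by
      funext x
      rw [hτ₂, Mem.set_row_of_ne (by simp), hτ₁, Mem.set_apply_same_row]
    have h16 : τ₂ 16 0 = cap k := by simp [hτ₂, Mem.set]
    have h12k : τ₂ 12 k = pr k := by simp [h12]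
    have hsell := exec_sell (m := m) (i := k) (v := v k) τ₂
      (by rw [hr₂ 6 (by simp) (by simp),
            hτ 6 (by simp) (by simp) (by simp) (by simp) (by simp) (by simp)]; exact hσ.bidders)
      (by rw [hr₂ 21 (by simp) (by simp), hcnt])
      (by rw [hr₂ 2 (by simp) (by simp),
            hτ 2 (by simp) (by simp) (by simp) (by simp) (by simp) (by simp)]; exact hσ.value k hk)
      (by rw [hr₂ 14 (by simp) (by simp)]; exact h2.le)
    rw [h16, h12k, hr₂ 14 (by simp) (by simp), hr₂ 15 (by simp) (by simp)] at hsell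
    have hwr : ∀ a, a ≠ 22 → a ≠ 14 → a ≠ 15 → a ≠ 16 →
        (BProg.iter 22 1 sell).exec τ₂ a = τ₂ a := by
      intro a h1 h2 h3 h4
      exact BProg.exec_row (by simp [BProg.Writes, sell, *]) _
    set υ := (BProg.iter 22 1 sell).exec τ₂ with hυ
    obtain ⟨s1, s2, s3, s4⟩ := hsell
    rw [show (υ.set 21 0 (k + 1)) 14 = υ 14 from Mem.set_row_of_ne (by simp),
      show (υ.set 21 0 (k + 1)) 15 = υ 15 from Mem.set_row_of_ne (by simp),
      show (υ.set 21 0 (k + 1)) 12 = υ 12 from Mem.set_row_of_ne (by simp)]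
    refine ⟨?_, ?_, ?_, ?_⟩
    · intro a h1 h2 h3 h4 h5 h6
      rw [Mem.set_row_of_ne h2, hwr a h1 h4 h5 h6, hr₂ a h3 h6, hτ a h1 h2 h3 h4 h5 h6]
    · intro i hi
      rw [hwr 12 (by simp) (by simp) (by simp) (by simp), h12]
      dsimp only
      split_ifs with hik
      · rw [hik]
      · exact h1 i (by omega)
    · refine h2.succ s1 (by omega) fun b hb hvb => ?_
      rcases s4 b hb hvb with h5 | h5
      · exact Or.inl h5
      · exact Or.inr (by omega)
    · rw [s3, h3, sum_range_succ]
      congr 1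
      refine sum_congr rfl fun i hi => ?_
      rw [IsGreedy.sold_eq (y' := υ 14) (y := τ 14) (mem_range.mp hi)]
      exact fun b hb => (s1 b hb).imp_right fun h => ⟨h.1, h.2.1⟩

/-! ### The table of partial solutions -/

/-- The position of the partial solution with items from `s` on and price levels below `a`. -/
def pos (n a s : ℕ) : ℕ := a * (n + 1) + s

/-- The pair is encoded in radix `n + 1`, since the first item `s` ranges over 0, …, `n`. -/
theorem pos_inj {n a s a' s' : ℕ} (hs : s ≤ n) (hs' : s' ≤ n) (h : pos n a s = pos n a' s') :
    a = a' ∧ s = s' := by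
  unfold pos at h
  have h1 : (a * (n + 1) + s) / (n + 1) = a := by
    rw [Nat.mul_comm, Nat.mul_add_div (by omega), Nat.div_eq_of_lt (by omega), add_zero]
  have h2 : (a' * (n + 1) + s') / (n + 1) = a' := by
    rw [Nat.mul_comm, Nat.mul_add_div (by omega), Nat.div_eq_of_lt (by omega), add_zero]
  have h3 : a = a' := by rw [← h1, h, h2]
  subst h3
  exact ⟨rfl, by omega⟩

theorem segment_disjoint {n u w i : ℕ} (hi : i < n) (h : w ≠ u) :
    w * n + i < u * n ∨ u * n + n ≤ w * n + i := by
  rcases lt_or_gt_of_ne h with h | h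
  · left
    have := Nat.mul_le_mul_right n (show w + 1 ≤ u from h)
    linarith
  · right
    have := Nat.mul_le_mul_right n (show u + 1 ≤ w from h)
    linarith

/-- All entries of the table are partial solutions. -/
def IsTable (n m : ℕ) (C : ℕ → ℕ) (v : ℕ → ℕ → ℕ) (B G A : ℕ) (σ : Mem) : Prop :=
  ∀ a ≤ A, ∀ s ≤ n, IsPartial n m C v B G a s (σ 8 (pos n a s))
    (fun i => σ 9 (pos n a s * n + i)) (fun b => σ 10 (pos n a s * m + b))

/-- The position of the entry that the block may improve. -/
def newPos : Expr := (.var 20 + 1) * .read 6 (.const 2) + .var 100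

/-- The position of the entry that the block extends. -/
def oldPos (K : ℕ) : Expr := (.var 20 + 1 - .const K) * .read 6 (.const 2) + .var (100 + K)

/-- The new entry is the block followed by the old entry. -/
def combine (K : ℕ) : BProg :=
  .seq (.iter 21 0 (.write 9 (newPos * .read 6 0 + .var 21)
      (.read 12 (.var 21) / (1 - (.var 21 + 1 - .var (100 + K))) +
        .read 9 (oldPos K * .read 6 0 + .var 21) / (1 - (.var (100 + K) - .var 21)))))
    (.seq (.iter 22 1 (.write 10 (newPos * .read 6 1 + .var 22)
      (.read 14 (.var 22) + .read 10 (oldPos K * .read 6 1 + .var 22) / (1 - .read 14 (.var 22)))))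
      (.write 8 newPos (.var 15 + .read 8 (oldPos K))))

/-- With truncated subtraction the test is nonzero exactly if the outer thresholds are in order and
the new value is at least the recorded one; the `+ 1` admits equality. -/
def update (K : ℕ) : BProg :=
  .ite ((1 - (.var 100 - .var (100 + K))) * (.var 15 + .read 8 (oldPos K) + 1 - .read 8 newPos))
    (combine K) .skip

/-- The block is completed by the greedy algorithm and recorded if it improves the table. -/
def body (G K : ℕ) : BProg := .seq (greedy G K) (update K)

theorem eval_newPos {n a : ℕ} (σ : Mem) (h6 : σ 6 2 = n + 1) (ha : σ 20 0 = a) :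
    newPos.eval σ = pos n (a + 1) (thresholds σ 0) := by
  simp [newPos, pos, h6, ha, thresholds]

theorem eval_oldPos {n a : ℕ} (K : ℕ) (σ : Mem) (h6 : σ 6 2 = n + 1) (ha : σ 20 0 = a) :
    (oldPos K).eval σ = pos n (a + 1 - K) (thresholds σ K) := by
  simp [oldPos, pos, h6, ha, thresholds]

/-- Arrays 8, 9 and 10 hold the values, prices and allocations of the table. Since `u' ≠ u`, the
entry being read occupies different segments from the one being written and stays intact throughout.
-/
theorem exec_combine {n m K a u u' : ℕ} (σ : Mem) (h0 : σ 6 0 = n) (h1 : σ 6 1 = m)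
    (h2 : σ 6 2 = n + 1) (ha : σ 20 0 = a) (hu : u = pos n (a + 1) (thresholds σ 0))
    (hu' : u' = pos n (a + 1 - K) (thresholds σ K)) (hne : u' ≠ u) :
    (∀ i < n, (combine K).exec σ 9 (u * n + i) =
      if i < thresholds σ K then σ 12 i else σ 9 (u' * n + i)) ∧
    (∀ w, w ≠ u → ∀ i < n, (combine K).exec σ 9 (w * n + i) = σ 9 (w * n + i)) ∧
    (∀ b < m, (combine K).exec σ 10 (u * m + b) =
      if σ 14 b ≠ 0 then σ 14 b else σ 10 (u' * m + b)) ∧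
    (∀ w, w ≠ u → ∀ b < m, (combine K).exec σ 10 (w * m + b) = σ 10 (w * m + b)) ∧
    (combine K).exec σ 8 u = σ 15 0 + σ 8 u' ∧
    (∀ w, w ≠ u → (combine K).exec σ 8 w = σ 8 w) := by
  have hthr : ∀ τ : Mem, (∀ l, τ (100 + l) = σ (100 + l)) → thresholds τ = thresholds σ := by
    intro τ h
    funext l
    simp [thresholds, h]
  set P := BProg.iter 21 0 (.write 9 (newPos * .read 6 0 + .var 21)
      (.read 12 (.var 21) / (1 - (.var 21 + 1 - .var (100 + K))) +
        .read 9 (oldPos K * .read 6 0 + .var 21) / (1 - (.var (100 + K) - .var 21)))) with hP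
  set Q := BProg.iter 22 1 (.write 10 (newPos * .read 6 1 + .var 22)
      (.read 14 (.var 22) + .read 10 (oldPos K * .read 6 1 + .var 22) / (1 - .read 14 (.var 22))))
    with hQ
  set σ₁ := P.exec σ with hσ₁
  set σ₂ := Q.exec σ₁ with hσ₂
  have r₁ : ∀ a, a ≠ 21 → a ≠ 9 → σ₁ a = σ a := fun a h h' =>
    BProg.exec_row (by simp [hP, BProg.Writes, h, h']) _
  have r₂ : ∀ a, a ≠ 22 → a ≠ 10 → σ₂ a = σ₁ a := fun a h h' =>
    BProg.exec_row (by simp [hQ, BProg.Writes, h, h']) _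
  have hex : (combine K).exec σ = σ₂.set 8 u (σ 15 0 + σ 8 u') := by
    have ht : thresholds σ₂ = thresholds σ := hthr _ fun l => by
      rw [r₂ _ (by omega) (by omega), r₁ _ (by omega) (by omega)]
    have e6 : σ₂ 6 2 = n + 1 := by
      rw [r₂ 6 (by simp) (by simp), r₁ 6 (by simp) (by simp), h2]
    have e20 : σ₂ 20 0 = a := by
      rw [r₂ 20 (by simp) (by simp), r₁ 20 (by simp) (by simp), ha]
    simp only [combine, BProg.exec, ← hP, ← hQ, ← hσ₁, ← hσ₂, Expr.eval_add, Expr.eval_var,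
      Expr.eval_read, eval_newPos σ₂ e6 e20, eval_oldPos K σ₂ e6 e20, ht, ← hu, ← hu']
    rw [r₂ 15 (by simp) (by simp), r₁ 15 (by simp) (by simp), r₂ 8 (by simp) (by simp),
      r₁ 8 (by simp) (by simp)]
  have hfP := exec_fill (i := 21) (p := 0) (arr := 9) (N := n) (base := u * n)
    (e := newPos * .read 6 0 + .var 21)
    (f := .read 12 (.var 21) / (1 - (.var 21 + 1 - .var (100 + K))) +
        .read 9 (oldPos K * .read 6 0 + .var 21) / (1 - (.var (100 + K) - .var 21)))
    (val := fun i => if i < thresholds σ K then σ 12 i else σ 9 (u' * n + i))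
    σ (by simp) h0 (by
      intro τ k hk hcnt hτ hτ9
      have ht : thresholds τ = thresholds σ := hthr _ fun l => hτ _ (by omega) (by omega)
      have htK : τ (100 + K) 0 = thresholds σ K := by rw [← ht]; rfl
      have e6 := hτ 6 (by simp) (by simp)
      have e20 := hτ 20 (by simp) (by simp)
      have e12 := hτ 12 (by simp) (by simp)
      have hold := hτ9 _ (segment_disjoint hk hne)
      simp only [Expr.eval_add, Expr.eval_mul, Expr.eval_div, Expr.eval_sub, Expr.eval_one,
        Expr.eval_read, Expr.eval_var, eval_newPos τ (by rw [e6, h2]) (by rw [e20, ha]),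
        eval_oldPos K τ (by rw [e6, h2]) (by rw [e20, ha]), Expr.eval_zero, ht, ← hu, ← hu', e6,
        e12, hcnt, h0, hold, htK, true_and]
      -- Exactly one of the two divisors is 1; the other is 0 and erases its summand.
      split_ifs with hlt
      · rw [show 1 - (k + 1 - thresholds σ K) = 1 by omega,
          show 1 - (thresholds σ K - k) = 0 by omega]
        simp
      · rw [show 1 - (k + 1 - thresholds σ K) = 0 by omega,
          show 1 - (thresholds σ K - k) = 1 by omega]
        simp)
  have hfQ := exec_fill (i := 22) (p := 1) (arr := 10) (N := m) (base := u * m)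
    (e := newPos * .read 6 1 + .var 22)
    (f := .read 14 (.var 22) + .read 10 (oldPos K * .read 6 1 + .var 22) /
      (1 - .read 14 (.var 22)))
    (val := fun b => if σ 14 b ≠ 0 then σ 14 b else σ 10 (u' * m + b))
    σ₁ (by simp) (by rw [r₁ bnd (by simp) (by simp)]; exact h1) (by
      intro τ k hk hcnt hτ hτ10
      have ht : thresholds τ = thresholds σ := hthr _ fun l => by
        rw [hτ _ (by omega) (by omega), r₁ _ (by omega) (by omega)]
      have e6 := (hτ 6 (by simp) (by simp)).trans (r₁ 6 (by simp) (by simp))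
      have e20 := (hτ 20 (by simp) (by simp)).trans (r₁ 20 (by simp) (by simp))
      have e14 := (hτ 14 (by simp) (by simp)).trans (r₁ 14 (by simp) (by simp))
      have hold := hτ10 _ (segment_disjoint hk hne)
      rw [r₁ 10 (by simp) (by simp)] at hold
      simp only [Expr.eval_add, Expr.eval_mul, Expr.eval_div, Expr.eval_sub, Expr.eval_one,
        Expr.eval_read, Expr.eval_var, eval_newPos τ (by rw [e6, h2]) (by rw [e20, ha]),
        eval_oldPos K τ (by rw [e6, h2]) (by rw [e20, ha]), ht, ← hu, ← hu', e6,
        e14, hcnt, h1, hold, true_and]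
      split_ifs with hne0
      · rw [show 1 - σ 14 k = 0 by omega]
        simp
      · rw [not_not.mp hne0]
        simp)
  have r8 : ∀ a, a ≠ 8 → (σ₂.set 8 u (σ 15 0 + σ 8 u')) a = σ₂ a :=
    fun a h => Mem.set_row_of_ne h
  rw [hex, r8 9 (by simp), r8 10 (by simp), r₂ 9 (by simp) (by simp)]
  refine ⟨hfP.1, fun w hw i hi => hfP.2 _ (segment_disjoint hi hw), hfQ.1,
    fun w hw b hb => (hfQ.2 _ (segment_disjoint hb hw)).trans ?_, ?_, fun w hw => ?_⟩
  · rw [r₁ 10 (by simp) (by simp)]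
  · simp [Mem.set]
  · rw [Mem.set_apply_same_row, if_neg hw, r₂ 8 (by simp) (by simp), r₁ 8 (by simp) (by simp)]

/-- One choice of thresholds. Soundness of the table comes from `IsPartial.extend`. The last claim
holds whether or not the entry is overwritten: its final value is at least the greedy profit plus
the old entry, and the greedy profit is at least half of any allocation's. -/
theorem exec_body {n m A B G K : ℕ} {C : ℕ → ℕ} {v : ℕ → ℕ → ℕ} (σ : Mem) (hK : 0 < K)
    (hG : ∀ k, (B + 1) * level B k ≤ level B (k + (G + 1)))
    (hσ : Holds n m A B C v σ) (htab : IsTable n m C v B G A σ) {a : ℕ} (ha : σ 20 0 = a)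
    (haA : a < A) (h0n : thresholds σ 0 ≤ n) (hKn : thresholds σ K ≤ n) :
    IsTable n m C v B G A ((body G K).exec σ) ∧
    (∀ w, σ 8 w ≤ (body G K).exec σ 8 w) ∧
    (∀ w, w ≠ pos n (a + 1) (thresholds σ 0) → (body G K).exec σ 8 w = σ 8 w) ∧
    (thresholds σ 0 ≤ thresholds σ K → ∀ x,
      IsAlloc n m v (blockCap C G K (thresholds σ)) (blockPrice B K (thresholds σ) a) x →
      ∑ b ∈ range m, pay (blockPrice B K (thresholds σ) a) x b +
        2 * (body G K).exec σ 8 (pos n (a + 1 - K) (thresholds σ K)) ≤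
        2 * (body G K).exec σ 8 (pos n (a + 1) (thresholds σ 0))) := by
  set d := thresholds σ with hd
  obtain ⟨g1, g2, g3⟩ := exec_greedy (G := G) (K := K) σ hσ ha haA
  rw [← hd] at g1 g2 g3
  set pr := blockPrice B K d a with hpr
  have r₁ : ∀ a, a ≠ 12 → a ≠ 14 → a ≠ 15 → a ≠ 16 → a ≠ 21 → a ≠ 22 →
      (greedy G K).exec σ a = σ a := fun a h1 h2 h3 h4 h5 h6 =>
    BProg.exec_row (by simp [greedy, sell, BProg.Writes, *]) _
  set σ₁ := (greedy G K).exec σ with hσ₁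
  have ht : thresholds σ₁ = d := by
    funext l
    unfold thresholds
    rw [r₁ _ (by omega) (by omega) (by omega) (by omega) (by omega) (by omega)]
    rfl
  have e6 : σ₁ 6 = σ 6 := r₁ 6 (by simp) (by simp) (by simp) (by simp) (by simp) (by simp)
  have e20 : σ₁ 20 = σ 20 := r₁ 20 (by simp) (by simp) (by simp) (by simp) (by simp) (by simp)
  have e8 : σ₁ 8 = σ 8 := r₁ 8 (by simp) (by simp) (by simp) (by simp) (by simp) (by simp)
  have e9 : σ₁ 9 = σ 9 := r₁ 9 (by simp) (by simp) (by simp) (by simp) (by simp) (by simp)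
  have e10 : σ₁ 10 = σ 10 := r₁ 10 (by simp) (by simp) (by simp) (by simp) (by simp) (by simp)
  have halloc : IsAlloc n m v (blockCap C G K d) pr (σ₁ 14) := ⟨g2.le, g2.afford, g2.supply⟩
  have hgreedy : ∀ x, IsAlloc n m v (blockCap C G K d) pr x →
      ∑ b ∈ range m, pay pr x b ≤ 2 * σ₁ 15 0 := by
    intro x hx
    rw [g3]
    exact sum_pay_le_two_mul (fun i j h _ => blockPrice_antitone B K d a h) g2.le g2.stable hx
  set u := pos n (a + 1) (d 0) with hu
  set u' := pos n (a + 1 - K) (d K) with hu'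
  -- The two entries differ in their level coordinate because `K > 0`.
  have hne : u' ≠ u := by
    intro h
    have := pos_inj hKn h0n h
    omega
  have hcond : (((1 - (.var 100 - .var (100 + K))) *
      (.var 15 + .read 8 (oldPos K) + 1 - .read 8 newPos) : Expr)).eval σ₁ ≠ 0 ↔
      d 0 ≤ d K ∧ σ 8 u ≤ σ₁ 15 0 + σ 8 u' := by
    have h6 : σ₁ 6 2 = n + 1 := by rw [e6]; exact hσ.thresholds
    have h20 : σ₁ 20 0 = a := by rw [e20]; exact ha
    have e0 : σ₁ 100 0 = d 0 := by rw [← ht]; rfl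
    have eK : σ₁ (100 + K) 0 = d K := by rw [← ht]; rfl
    simp only [Expr.eval_mul, Expr.eval_sub, Expr.eval_add, Expr.eval_one, Expr.eval_var,
      Expr.eval_read, eval_newPos σ₁ h6 h20, eval_oldPos K σ₁ h6 h20, ht, ← hu, ← hu', e8, e0, eK,
      ne_eq, mul_eq_zero, not_or]
    omega
  have hexb : (body G K).exec σ = (update K).exec σ₁ := rfl
  by_cases hc : d 0 ≤ d K ∧ σ 8 u ≤ σ₁ 15 0 + σ 8 u'
  · have hex : (body G K).exec σ = (combine K).exec σ₁ := by
      rw [hexb, update, BProg.exec, if_pos (hcond.mpr hc)]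
    obtain ⟨c1, c2, c3, c4, c5, c6⟩ := exec_combine (n := n) (m := m) (K := K) (a := a) (u := u)
      (u' := u') σ₁ (by rw [e6]; exact hσ.items) (by rw [e6]; exact hσ.bidders)
      (by rw [e6]; exact hσ.thresholds) (by rw [e20]; exact ha) (by rw [ht]) (by rw [ht]) hne
    rw [← hex] at c1 c2 c3 c4 c5 c6
    set τ := (body G K).exec σ with hτ
    rw [ht, e9] at c1
    rw [e10] at c3
    rw [e9] at c2
    rw [e10] at c4
    rw [e8] at c5 c6
    refine ⟨?_, ?_, c6, ?_⟩
    · intro a' ha' s hs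
      by_cases hw : pos n a' s = u
      · obtain ⟨rfl, rfl⟩ := pos_inj hs h0n hw
        rw [← hu, c5, g3]
        refine ((htab (a + 1 - K) (by omega) (d K) hKn).extend hK hG hc.1 halloc).congr ?_ ?_
        · intro i hi
          rw [c1 i hi, g1 i hi]
        · intro b hb
          rw [c3 b hb]
      · rw [c6 _ hw]
        exact (htab a' ha' s hs).congr (fun i hi => c2 _ hw i hi) (fun b hb => c4 _ hw b hb)
    · intro w
      by_cases hw : w = u
      · rw [hw, c5]
        exact hc.2
      · rw [c6 w hw]
    · intro _ x hx
      have := hgreedy x hx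
      rw [c5, c6 _ hne]
      omega
  · have hex : (body G K).exec σ = σ₁ := by
      rw [hexb, update, BProg.exec, if_neg fun h => hc (hcond.mp h)]
      rfl
    rw [hex, e8]
    refine ⟨?_, fun _ => le_rfl, fun _ _ => rfl, ?_⟩
    · intro a' ha' s hs
      rw [e8, e9, e10]
      exact htab a' ha' s hs
    · intro hle x hx
      have := hgreedy x hx
      omega

/-! ### All choices of thresholds -/

/-- The program `c` for all values of the first `k` thresholds. -/
def nest : ℕ → BProg → BProg
  | 0, c => c
  | k + 1, c => .iter (100 + k) 2 (nest k c)

theorem nest_writes {c : BProg} {k a : ℕ} :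
    (nest k c).Writes a ↔ c.Writes a ∨ ∃ l < k, a = 100 + l := by
  induction k with
  | zero => simp [nest]
  | succ k ih =>
    simp only [nest, BProg.Writes, ih]
    constructor
    · rintro (h | h | ⟨l, hl, h⟩)
      · exact Or.inr ⟨k, by omega, h⟩
      · exact Or.inl h
      · exact Or.inr ⟨l, by omega, h⟩
    · rintro (h | ⟨l, hl, h⟩)
      · exact Or.inr (Or.inl h)
      · rcases Nat.lt_succ_iff_lt_or_eq.mp hl with h1 | rfl
        · exact Or.inr (Or.inr ⟨l, h1, h⟩)
        · exact Or.inl h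

theorem nest_wf {c : BProg} (hc : c.WF) (hw : ∀ a, 100 ≤ a → ¬ c.Writes a) (k : ℕ) :
    (nest k c).WF := by
  induction k with
  | zero => exact hc
  | succ k ih =>
    refine ⟨ih, ?_⟩
    rw [nest_writes, not_or]
    refine ⟨hw _ (by omega), ?_⟩
    rintro ⟨l, hl, h⟩
    omega

/-- A rule for exhaustive search: `Inv` is maintained, while `Good d` is established when the loops
reach the tuple `d` and survives all later passes. The induction on `k` lets the inner `k`
thresholds vary and keeps the outer ones fixed. -/
theorem exec_nest {c : BProg} (hw : ∀ a, 100 ≤ a → ¬ c.Writes a) {n M : ℕ} {Inv : Mem → Prop}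
    {Good : (ℕ → ℕ) → Mem → Prop} (hset : ∀ σ a x, 100 ≤ a → Inv σ → Inv (σ.set a 0 x))
    (hgset : ∀ d σ a x, 100 ≤ a → Good d σ → Good d (σ.set a 0 x))
    (hn : ∀ σ, Inv σ → σ bnd 2 = n + 1)
    (hbody : ∀ σ, Inv σ → (∀ l < M, thresholds σ l ≤ n) → Inv (c.exec σ) ∧
      (∀ d, Good d σ → Good d (c.exec σ)) ∧
      ∀ d, (∀ l < M, d l = thresholds σ l) → Good d (c.exec σ))
    {k : ℕ} (hk : k ≤ M) (σ : Mem) (hσ : Inv σ)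
    (hl : ∀ l, k ≤ l → l < M → thresholds σ l ≤ n) :
    Inv ((nest k c).exec σ) ∧ (∀ d, Good d σ → Good d ((nest k c).exec σ)) ∧
      ∀ d, (∀ l < k, d l ≤ n) → (∀ l, k ≤ l → l < M → d l = thresholds σ l) →
        Good d ((nest k c).exec σ) := by
  induction k generalizing σ with
  | zero =>
    obtain ⟨h1, h2, h3⟩ := hbody σ hσ fun l h => hl l (Nat.zero_le _) h
    exact ⟨h1, h2, fun d _ h => h3 d fun l hlM => h l (Nat.zero_le _) hlM⟩
  | succ k ih =>
    have h := BProg.exec_iter (i := 100 + k) (p := 2) (c := nest k c) (σ := σ) (N := n + 1)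
      (fun j τ => Inv τ ∧ (∀ d, Good d σ → Good d τ) ∧
        (∀ l, k + 1 ≤ l → l < M → thresholds τ l = thresholds σ l) ∧
        ∀ d, (∀ l < k, d l ≤ n) → d k < j → (∀ l, k + 1 ≤ l → l < M → d l = thresholds σ l) →
          Good d τ) (hn σ hσ) ?_ ?_
    · refine ⟨h.1, h.2.1, fun d h1 h2 => h.2.2.2 d (fun l hl => h1 l (by omega)) ?_ h2⟩
      exact Nat.lt_succ_of_le (h1 k (by omega))
    · refine ⟨hset _ _ _ (by omega) hσ, fun d hd => hgset _ _ _ _ (by omega) hd, ?_, by simp⟩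
      intro l h1 h2
      unfold thresholds
      rw [Mem.set_row_of_ne (by omega)]
    · rintro j τ hj hcnt ⟨h1, h2, h3, h4⟩
      have hτk : thresholds τ k = j := hcnt
      obtain ⟨i1, i2, i3⟩ := ih (by omega) τ h1 (by
        intro l hkl hlM
        rcases Nat.eq_or_lt_of_le hkl with rfl | hkl
        · omega
        · rw [h3 l hkl hlM]
          exact hl l hkl hlM)
      refine ⟨hset _ _ _ (by omega) i1, fun d hd => hgset _ _ _ _ (by omega) (i2 d (h2 d hd)),
        ?_, ?_⟩
      · intro l hkl hlM
        rw [← h3 l hkl hlM]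
        unfold thresholds
        rw [Mem.set_row_of_ne (by omega), BProg.exec_row]
        rw [nest_writes, not_or]
        refine ⟨hw _ (by omega), ?_⟩
        rintro ⟨l', hl', h⟩
        omega
      · intro d hd hdk hdl
        refine hgset _ _ _ _ (by omega) ?_
        rcases Nat.lt_succ_iff_lt_or_eq.mp hdk with hlt | heq
        · exact i2 d (h4 d hd hlt hdl)
        · refine i3 d hd fun l hkl hlM => ?_
          rcases Nat.eq_or_lt_of_le hkl with rfl | hkl
          · rw [heq, hτk]
          · rw [h3 l hkl hlM]
            exact hdl l hkl hlM

theorem body_writes {G K a : ℕ} (h : (body G K).Writes a) : 8 ≤ a ∧ a < 100 ∧ a ≠ 20 ∧ a ≠ 19 := by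
  simp only [body, greedy, sell, update, combine, BProg.Writes, or_false] at h
  omega

/-- The table entries for the blocks with highest level `a` reflect the block with thresholds
`d`. -/
def Seen (n m : ℕ) (C : ℕ → ℕ) (v : ℕ → ℕ → ℕ) (B G K a : ℕ) (d : ℕ → ℕ) (σ : Mem) : Prop :=
  d 0 ≤ n → d K ≤ n → d 0 ≤ d K → ∀ x,
    IsAlloc n m v (blockCap C G K d) (blockPrice B K d a) x →
    ∑ b ∈ range m, pay (blockPrice B K d a) x b + 2 * σ 8 (pos n (a + 1 - K) (d K)) ≤
      2 * σ 8 (pos n (a + 1) (d 0))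

/-- The search for a fixed `a` writes only row `a + 1` of the table and reads row `a + 1 - K`. The
new values can only increase and the old ones are constant, so the inequality `Seen`, once true,
remains true. -/
theorem exec_nest_body {n m A B G K : ℕ} {C : ℕ → ℕ} {v : ℕ → ℕ → ℕ} (σ : Mem) (hK : 0 < K)
    (hG : ∀ k, (B + 1) * level B k ≤ level B (k + (G + 1)))
    (hσ : Holds n m A B C v σ) (htab : IsTable n m C v B G A σ) {a : ℕ} (ha : σ 20 0 = a)
    (haA : a < A) :
    IsTable n m C v B G A ((nest (K + 1) (body G K)).exec σ) ∧
    (∀ w, (∀ s ≤ n, w ≠ pos n (a + 1) s) → (nest (K + 1) (body G K)).exec σ 8 w = σ 8 w) ∧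
    ∀ d : ℕ → ℕ, (∀ l ≤ K, d l ≤ n) →
      Seen n m C v B G K a d ((nest (K + 1) (body G K)).exec σ) := by
  have hold : ∀ t ≤ n, ∀ s ≤ n, pos n (a + 1 - K) t ≠ pos n (a + 1) s := by
    intro t ht s hs h
    have := pos_inj ht hs h
    omega
  have h := exec_nest (c := body G K) (n := n) (M := K + 1)
    (Inv := fun τ => Holds n m A B C v τ ∧ IsTable n m C v B G A τ ∧ τ 20 0 = a ∧
      ∀ w, (∀ s ≤ n, w ≠ pos n (a + 1) s) → τ 8 w = σ 8 w)
    (Good := Seen n m C v B G K a)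
    (fun a' ha' h => by have := body_writes h; omega)
    ?_ ?_ (fun σ h => h.1.thresholds) ?_ le_rfl σ ⟨hσ, htab, ha, fun _ _ => rfl⟩
    (fun l h1 h2 => by omega)
  · exact ⟨h.1.2.1, h.1.2.2.2, fun d hd => h.2.2 d (fun l hl => hd l (by omega))
      (fun l h1 h2 => by omega)⟩
  · rintro τ a' x ha' ⟨h1, h2, h3, h4⟩
    have r : ∀ a'', a'' < 100 → (τ.set a' 0 x) a'' = τ a'' := fun a'' h =>
      Mem.set_row_of_ne (by omega)
    refine ⟨h1.congr (r _ (by omega)) (r _ (by omega)) (r _ (by omega)) (r _ (by omega)), ?_, ?_,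
      ?_⟩
    · unfold IsTable
      rwa [r _ (by omega), r _ (by omega), r _ (by omega)]
    · rwa [r _ (by omega)]
    · rwa [r _ (by omega)]
  · intro d τ a' x ha' h
    unfold Seen
    rwa [Mem.set_row_of_ne (by omega)]
  · rintro τ ⟨h1, h2, h3, h4⟩ hthr
    obtain ⟨b1, b2, b3, b4⟩ := exec_body τ hK hG h1 h2 h3 haA (hthr 0 (by omega)) (hthr K (by omega))
    have r : ∀ a', a' < 8 ∨ a' = 20 → (body G K).exec τ a' = τ a' := fun a' h =>
      BProg.exec_row (fun hw => by have := body_writes hw; omega) _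
    refine ⟨⟨h1.congr (r _ (by omega)) (r _ (by omega)) (r _ (by omega)) (r _ (by omega)), b1, ?_,
      ?_⟩, ?_, ?_⟩
    · rw [r 20 (by omega), h3]
    · intro w hw
      rw [b3 w (hw _ (hthr 0 (by omega))), h4 w hw]
    · intro d hd h0 hdK hle x hx
      have := hd h0 hdK hle x hx
      have := b2 (pos n (a + 1) (d 0))
      rw [b3 _ (hold (d K) hdK _ (hthr 0 (by omega)))]
      omega
    · intro d hd h0 hdK hle x hx
      -- `d` and the memory agree only at positions up to `K`; prices and supplies depend on no
      -- others.
      have hdepth : depth K d = depth K (thresholds τ) := by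
        funext i
        unfold depth
        refine sum_congr rfl fun l hl => ?_
        rw [mem_range] at hl
        rw [hd (l + 1) (by omega)]
      have hpr : blockPrice B K d a = blockPrice B K (thresholds τ) a := by
        funext i
        rw [blockPrice, blockPrice, hdepth]
      have hcap : blockCap C G K d = blockCap C G K (thresholds τ) := by
        funext i
        rw [blockCap, blockCap, hdepth, hd 0 (by omega), hd K (by omega)]
      rw [hpr, hcap] at hx
      rw [hd 0 (by omega), hd K (by omega)] at hle ⊢
      rw [hpr]
      exact b4 hle x hx

/-! ### The main loop -/

/-- If the best solution with levels up to `σ 20 0` improves on the output, it becomes the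
output. -/
def finish : BProg :=
  .ite (.read 8 ((.var 20 + 1) * .read 6 (.const 2)) - .var 19)
    (.seq (.write 19 0 (.read 8 ((.var 20 + 1) * .read 6 (.const 2))))
      (.seq (.iter 21 0 (.write 3 (.var 21)
          (.read 9 ((.var 20 + 1) * .read 6 (.const 2) * .read 6 0 + .var 21))))
        (.iter 22 1 (.write 5 (.var 22)
          (.read 10 ((.var 20 + 1) * .read 6 (.const 2) * .read 6 1 + .var 22))))))
    .skip

/-- Array 19 holds the value of the best entry so far with first item 0, that is, one that covers
all items. The output is copied together with it, so it is always a partial solution for that value.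
-/
theorem exec_finish {n m A B G : ℕ} {C : ℕ → ℕ} {v : ℕ → ℕ → ℕ} (σ : Mem)
    (hσ : Holds n m A B C v σ) (htab : IsTable n m C v B G A σ) {a : ℕ} (ha : σ 20 0 = a)
    (haA : a < A) (hout : ∃ a', IsPartial n m C v B G a' 0 (σ 19 0) (σ 3) (σ 5)) :
    (∃ a', IsPartial n m C v B G a' 0 (finish.exec σ 19 0) (finish.exec σ 3) (finish.exec σ 5)) ∧
      σ 19 0 ≤ finish.exec σ 19 0 ∧ σ 8 (pos n (a + 1) 0) ≤ finish.exec σ 19 0 := by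
  have hpos : ∀ τ : Mem, τ 20 0 = a → τ 6 2 = n + 1 →
      ((.var 20 + 1) * .read 6 (.const 2) : Expr).eval τ = pos n (a + 1) 0 := by
    intro τ h1 h2
    simp [pos, h1, h2]
  have hposσ := hpos σ ha hσ.thresholds
  set u := pos n (a + 1) 0 with hu
  by_cases hc : σ 8 u - σ 19 0 ≠ 0
  · set σ₁ := σ.set 19 0 (σ 8 u) with hσ₁
    set P := BProg.iter 21 0 (.write 3 (.var 21)
          (.read 9 ((.var 20 + 1) * .read 6 (.const 2) * .read 6 0 + .var 21))) with hP
    set Q := BProg.iter 22 1 (.write 5 (.var 22)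
          (.read 10 ((.var 20 + 1) * .read 6 (.const 2) * .read 6 1 + .var 22))) with hQ
    have hex : finish.exec σ = Q.exec (P.exec σ₁) := by
      rw [finish, BProg.exec, if_pos (by
        rw [Expr.eval_sub, Expr.eval_read, hposσ]
        exact hc)]
      simp only [BProg.exec, Expr.eval_read, hposσ, Expr.eval_zero, ← hσ₁]
      rfl
    have r₁ : ∀ a, a ≠ 19 → σ₁ a = σ a := fun a h => Mem.set_row_of_ne h
    have r₂ : ∀ a, a ≠ 21 → a ≠ 3 → P.exec σ₁ a = σ₁ a := fun a h h' =>
      BProg.exec_row (by simp [hP, BProg.Writes, h, h']) _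
    have r₃ : ∀ a, a ≠ 22 → a ≠ 5 → Q.exec (P.exec σ₁) a = P.exec σ₁ a := fun a h h' =>
      BProg.exec_row (by simp [hQ, BProg.Writes, h, h']) _
    have e19 : finish.exec σ 19 0 = σ 8 u := by
      rw [hex, r₃ 19 (by simp) (by simp), r₂ 19 (by simp) (by simp)]
      simp [hσ₁, Mem.set]
    have h3 : ∀ i < n, finish.exec σ 3 i = σ 9 (u * n + i) := by
      have h := (exec_fill (i := 21) (p := 0) (arr := 3) (N := n) (base := 0) (e := .var 21)
        (f := .read 9 ((.var 20 + 1) * .read 6 (.const 2) * .read 6 0 + .var 21))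
        (val := fun i => σ 9 (u * n + i)) σ₁ (by simp)
        (by rw [r₁ _ (by simp)]; exact hσ.items) (by
          intro τ k hk hcnt hτ _
          have e (b) (h1 : b ≠ 3) (h2 : b ≠ 21) (h3 : b ≠ 19) : τ b = σ b :=
            (hτ b h1 h2).trans (r₁ b h3)
          rw [Expr.eval_read, Expr.eval_add, Expr.eval_mul,
            hpos τ (by rw [e 20 (by simp) (by simp) (by simp), ha])
              (by rw [e 6 (by simp) (by simp) (by simp)]; exact hσ.thresholds)]
          simp only [Expr.eval_var, Expr.eval_read, Expr.eval_zero, hcnt,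
            e 6 (by simp) (by simp) (by simp), e 9 (by simp) (by simp) (by simp), hσ.items]
          simp)).1
      intro i hi
      rw [hex, r₃ 3 (by simp) (by simp), ← h i hi, zero_add]
    have h5 : ∀ b < m, finish.exec σ 5 b = σ 10 (u * m + b) := by
      have h := (exec_fill (i := 22) (p := 1) (arr := 5) (N := m) (base := 0) (e := .var 22)
        (f := .read 10 ((.var 20 + 1) * .read 6 (.const 2) * .read 6 1 + .var 22))
        (val := fun b => σ 10 (u * m + b)) (P.exec σ₁) (by simp)
        (by rw [r₂ _ (by simp) (by simp), r₁ _ (by simp)]; exact hσ.bidders) (by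
          intro τ k hk hcnt hτ _
          have e (b) (h1 : b ≠ 5) (h2 : b ≠ 22) (h3 : b ≠ 19) (h4 : b ≠ 21) (h5 : b ≠ 3) :
              τ b = σ b := (hτ b h1 h2).trans ((r₂ b h4 h5).trans (r₁ b h3))
          rw [Expr.eval_read, Expr.eval_add, Expr.eval_mul,
            hpos τ (by rw [e 20 (by simp) (by simp) (by simp) (by simp) (by simp), ha])
              (by rw [e 6 (by simp) (by simp) (by simp) (by simp) (by simp)]; exact hσ.thresholds)]
          simp only [Expr.eval_var, Expr.eval_read, Expr.eval_one, hcnt,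
            e 6 (by simp) (by simp) (by simp) (by simp) (by simp),
            e 10 (by simp) (by simp) (by simp) (by simp) (by simp), hσ.bidders]
          simp)).1
      intro b hb
      rw [hex, ← h b hb, zero_add]
    refine ⟨⟨a + 1, ?_⟩, ?_, ?_⟩
    · rw [e19]
      exact (htab (a + 1) haA 0 (Nat.zero_le _)).congr h3 h5
    · rw [e19]
      omega
    · rw [e19]
  · have hex : finish.exec σ = σ := by
      rw [finish, BProg.exec, if_neg (by
        rw [Expr.eval_sub, Expr.eval_read, hposσ]
        exact hc)]
      rfl
    rw [hex]
    exact ⟨hout, le_rfl, by omega⟩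

theorem finish_writes {a : ℕ} (h : finish.Writes a) :
    a = 3 ∨ a = 5 ∨ a = 19 ∨ a = 21 ∨ a = 22 := by
  simp only [finish, BProg.Writes, or_false] at h
  omega

/-- The algorithm, once the number of rounds has been determined. -/
def solve (B G K : ℕ) : BProg :=
  .seq (.iter 20 3 (.write 7 (.var 20 + 1)
      (.read 7 (.var 20) + .read 7 (.var 20) / .const B + 1)))
    (.seq (.iter 21 0 (.write 4 (.var 21) 1))
      (.iter 20 3 (.seq (nest (K + 1) (body G K)) finish)))

/-- Round `a` fills row `a + 1` and leaves the earlier rows alone, so the inequalities of earlier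
rounds persist. The zero-filled initial memory already represents a valid table and output in which
nothing is sold. -/
theorem exec_solve {n m A B G K : ℕ} {C : ℕ → ℕ} {v : ℕ → ℕ → ℕ} (σ : Mem) (hK : 0 < K)
    (hG : ∀ k, (B + 1) * level B k ≤ level B (k + (G + 1)))
    (h0 : σ 6 0 = n) (h1 : σ 6 1 = m) (h2 : σ 6 2 = n + 1) (h3 : σ 6 3 = A)
    (hC : ∀ i < n, σ 1 i = C i) (hv : ∀ i < n, ∀ b < m, σ 2 (i * m + b) = v i b)
    (hz : ∀ a, a = 3 ∨ a = 5 ∨ a = 7 ∨ a = 8 ∨ a = 9 ∨ a = 10 ∨ a = 19 → ∀ k, σ a k = 0) :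
    (∀ i < n, (solve B G K).exec σ 4 i = 1) ∧ ∃ (best : ℕ) (D : ℕ → ℕ → ℕ),
      (∃ a, IsPartial n m C v B G a 0 best ((solve B G K).exec σ 3) ((solve B G K).exec σ 5)) ∧
      (∀ a < A, ∀ d : ℕ → ℕ, (∀ l ≤ K, d l ≤ n) → d 0 ≤ d K → ∀ x,
        IsAlloc n m v (blockCap C G K d) (blockPrice B K d a) x →
        ∑ b ∈ range m, pay (blockPrice B K d a) x b + 2 * D (a + 1 - K) (d K) ≤
          2 * D (a + 1) (d 0)) ∧
      ∀ a, 0 < a → a ≤ A → D a 0 ≤ best := by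
  set P := BProg.iter 20 3 (.write 7 (.var 20 + 1)
      (.read 7 (.var 20) + .read 7 (.var 20) / .const B + 1)) with hP
  set Q := BProg.iter 21 0 (.write 4 (.var 21) 1) with hQ
  set R := BProg.iter 20 3 (.seq (nest (K + 1) (body G K)) finish) with hR
  set σ₁ := P.exec σ with hσ₁
  set σ₂ := Q.exec σ₁ with hσ₂
  have hex : (solve B G K).exec σ = R.exec σ₂ := rfl
  have r₁ : ∀ a, a ≠ 20 → a ≠ 7 → σ₁ a = σ a := fun a h h' =>
    BProg.exec_row (by simp [hP, BProg.Writes, h, h']) _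
  have r₂ : ∀ a, a ≠ 21 → a ≠ 4 → σ₂ a = σ₁ a := fun a h h' =>
    BProg.exec_row (by simp [hQ, BProg.Writes, h, h']) _
  have hlev : ∀ k ≤ A, σ₁ 7 k = level B k := by
    refine BProg.exec_iter (i := 20) (p := 3) (σ := σ) (N := A)
      (fun j τ => ∀ k ≤ j, τ 7 k = level B k) h3 ?_ ?_
    · intro k hk
      rw [Mem.set_row_of_ne (by simp), hz 7 (by simp), Nat.le_zero.mp hk, level]
    · intro j τ hj hcnt hτ k hk
      rw [Mem.set_row_of_ne (by simp)]
      simp only [BProg.exec, Expr.eval_add, Expr.eval_var, Expr.eval_one, Expr.eval_read,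
        Expr.eval_div, Expr.eval_const, hcnt, hτ j le_rfl, Mem.set_apply_same_row]
      split_ifs with hkj
      · rw [hkj, level]
      · exact hτ k (by omega)
  have h4 : ∀ i < n, σ₂ 4 i = 1 := by
    have h := (exec_fill (i := 21) (p := 0) (arr := 4) (N := n) (base := 0) (e := .var 21) (f := 1)
      (val := fun _ => 1) σ₁ (by simp) (by rw [r₁ _ (by simp) (by simp)]; exact h0)
      (fun τ k _ h _ _ => by simpa using h)).1
    intro i hi
    rw [← h i hi, zero_add]
  have e (a) (ha : a ≠ 20) (ha' : a ≠ 7) (ha'' : a ≠ 21) (ha''' : a ≠ 4) : σ₂ a = σ a :=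
    (r₂ a ha'' ha''').trans (r₁ a ha ha')
  have hH : Holds n m A B C v σ₂ := by
    have e6 := e 6 (by simp) (by simp) (by simp) (by simp)
    refine ⟨by rw [e6, h0], by rw [e6, h1], by rw [e6, h2], by rw [e6, h3], ?_, ?_, ?_⟩
    · rw [e 1 (by simp) (by simp) (by simp) (by simp)]
      exact hC
    · rw [e 2 (by simp) (by simp) (by simp) (by simp)]
      exact hv
    · rw [r₂ 7 (by simp) (by simp)]
      exact fun k hk => hlev k hk.le
  have hzero : ∀ a, a = 3 ∨ a = 5 ∨ a = 8 ∨ a = 9 ∨ a = 10 ∨ a = 19 → ∀ k, σ₂ a k = 0 := by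
    intro a ha k
    rw [e a (by omega) (by omega) (by omega) (by omega)]
    exact hz a (by omega) k
  have hTab : IsTable n m C v B G A σ₂ := by
    intro a _ s _
    rw [hzero 8 (by simp)]
    exact (IsPartial.zero n m C v B G a s).congr (fun i _ => hzero 9 (by simp) _)
      (fun b _ => hzero 10 (by simp) _)
  have hOut : ∃ a', IsPartial n m C v B G a' 0 (σ₂ 19 0) (σ₂ 3) (σ₂ 5) := by
    refine ⟨0, ?_⟩
    rw [hzero 19 (by simp)]
    exact (IsPartial.zero n m C v B G 0 0).congr (fun i _ => hzero 3 (by simp) _)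
      (fun b _ => hzero 5 (by simp) _)
  have hloop := BProg.exec_iter (i := 20) (p := 3)
    (c := .seq (nest (K + 1) (body G K)) finish) (σ := σ₂) (N := A)
    (fun a τ => Holds n m A B C v τ ∧ IsTable n m C v B G A τ ∧
      (∃ a', IsPartial n m C v B G a' 0 (τ 19 0) (τ 3) (τ 5)) ∧
      (∀ a' < a, ∀ d : ℕ → ℕ, (∀ l ≤ K, d l ≤ n) → Seen n m C v B G K a' d τ) ∧
      ∀ a', 0 < a' → a' ≤ a → τ 8 (pos n a' 0) ≤ τ 19 0) hH.rounds ?_ ?_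
  · obtain ⟨-, -, l3, l4, l5⟩ := hloop
    refine ⟨?_, (R.exec σ₂) 19 0, fun a s => (R.exec σ₂) 8 (pos n a s), l3, ?_, l5⟩
    · intro i hi
      rw [hex, BProg.exec_row, h4 i hi]
      rw [hR, BProg.Writes, BProg.Writes, nest_writes]
      rintro (h | (h | ⟨l, _, h⟩) | h)
      · omega
      · have := body_writes h
        omega
      · omega
      · have := finish_writes h
        omega
    · exact fun a ha d hd hle => l4 a ha d hd (hd 0 (Nat.zero_le _)) (hd K le_rfl) hle
  · have r : ∀ a, a ≠ 20 → (σ₂.set 20 0 0) a = σ₂ a := fun a h => Mem.set_row_of_ne h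
    refine ⟨hH.congr (r _ (by simp)) (r _ (by simp)) (r _ (by simp)) (r _ (by simp)), ?_, ?_,
      by simp, fun a' h h' => by omega⟩
    · unfold IsTable
      rwa [r _ (by simp), r _ (by simp), r _ (by simp)]
    · rwa [r _ (by simp), r _ (by simp), r _ (by simp)]
  · rintro a τ ha hcnt ⟨t1, t2, t3, t4, t5⟩
    obtain ⟨n1, n2, n3⟩ := exec_nest_body (B := B) (G := G) (K := K) τ hK hG t1 t2 hcnt ha
    have rn : ∀ a', a' < 8 ∨ a' = 20 ∨ a' = 19 →
        (nest (K + 1) (body G K)).exec τ a' = τ a' := by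
      intro a' ha'
      refine BProg.exec_row ?_ _
      rw [nest_writes]
      rintro (h | ⟨l, _, h⟩)
      · have := body_writes h
        omega
      · omega
    set υ := (nest (K + 1) (body G K)).exec τ with hυ
    have hHυ : Holds n m A B C v υ :=
      t1.congr (rn _ (by simp)) (rn _ (by simp)) (rn _ (by simp)) (rn _ (by simp))
    obtain ⟨f1, f2, f3⟩ := exec_finish υ hHυ n1 (a := a) (by rw [rn 20 (by simp), hcnt]) ha
      (by rwa [rn 19 (by simp), rn 3 (by simp), rn 5 (by simp)])
    have rf : ∀ a', a' = 1 ∨ a' = 2 ∨ a' = 6 ∨ a' = 7 ∨ a' = 8 ∨ a' = 9 ∨ a' = 10 →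
        finish.exec υ a' = υ a' := by
      intro a' ha'
      refine BProg.exec_row (fun h => ?_) _
      have := finish_writes h
      omega
    have r : ∀ b, b ≠ 20 → ((BProg.exec (.seq (nest (K + 1) (body G K)) finish) τ).set 20 0
        (a + 1)) b = finish.exec υ b := fun b h => Mem.set_row_of_ne h
    have hrow : ∀ a' s, a' ≤ a → s ≤ n → υ 8 (pos n a' s) = τ 8 (pos n a' s) := by
      intro a' s ha' hs
      refine n2 _ fun s' hs' h => ?_
      have := pos_inj hs hs' h
      omega
    refine ⟨?_, ?_, ?_, ?_, ?_⟩
    · refine hHυ.congr ?_ ?_ ?_ ?_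
      · rw [r _ (by simp), rf _ (by simp)]
      · rw [r _ (by simp), rf _ (by simp)]
      · rw [r _ (by simp), rf _ (by simp)]
      · rw [r _ (by simp), rf _ (by simp)]
    · unfold IsTable
      rw [r 8 (by simp), r 9 (by simp), r 10 (by simp), rf 8 (by simp), rf 9 (by simp),
        rf 10 (by simp)]
      exact n1
    · rwa [r 19 (by simp), r 3 (by simp), r 5 (by simp)]
    · intro a' ha' d hd
      unfold Seen
      rw [r 8 (by simp), rf 8 (by simp)]
      rcases Nat.lt_succ_iff_lt_or_eq.mp ha' with h | rfl
      · have h' := t4 a' h d hd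
        unfold Seen at h'
        rw [hrow _ _ (by omega) (hd K le_rfl), hrow _ _ (by omega) (hd 0 (Nat.zero_le _))]
        exact h'
      · exact n3 d hd
    · intro a' h1 h2
      rw [r 8 (by simp), rf 8 (by simp), r 19 (by simp)]
      rcases Nat.lt_succ_iff_lt_or_eq.mp (Nat.lt_succ_of_le h2) with h | rfl
      · rw [hrow a' 0 (by omega) (Nat.zero_le _)]
        rw [rn 19 (by simp)] at f2
        exact (t5 a' h1 (by omega)).trans f2
      · exact f3

/-! ### Solutions with integer data -/

/-- The number of copies, as a function on the natural numbers. -/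
def Instance.copies (I : Instance) (i : ℕ) : ℕ := if h : i < I.n then I.C ⟨i, h⟩ else 0

/-- The valuation matrix, as a function on the natural numbers. -/
def Instance.value (I : Instance) (i b : ℕ) : ℕ :=
  if h : i < I.n ∧ b < I.m then I.v ⟨i, h.1⟩ ⟨b, h.2⟩ else 0

@[simp] theorem Instance.copies_fin (I : Instance) (i : Fin I.n) : I.copies i = I.C i := by
  simp [copies]

@[simp] theorem Instance.value_fin (I : Instance) (i : Fin I.n) (b : Fin I.m) :
    I.value i b = I.v i b := by
  simp [value]

theorem card_filter_fin (m : ℕ) (p : ℕ → Prop) [DecidablePred p] :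
    #{b : Fin m | p b} = #{b ∈ range m | p b} := by
  rw [card_filter, card_filter, Finset.sum_range]

/-- The solution with integer prices `P` and allocation `X` (`0` for no item, `i + 1` for
item `i`). -/
def Instance.solution (I : Instance) (P X : ℕ → ℕ) : Solution I where
  p i := (P i : NNRat)
  x b := if h : X b ≠ 0 ∧ X b ≤ I.n then some ⟨X b - 1, by omega⟩ else none

theorem Instance.solution_x_eq_some {I : Instance} {P X : ℕ → ℕ} {b : Fin I.m} {i : Fin I.n} :
    (I.solution P X).x b = some i ↔ X b = i + 1 := by
  have := i.isLt
  simp only [solution, Option.dite_none_right_eq_some, Option.some.injEq, Fin.ext_iff]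
  constructor
  · rintro ⟨h, h'⟩
    omega
  · intro h
    exact ⟨by omega, by omega⟩

theorem Instance.solution_feasible {I : Instance} {P X : ℕ → ℕ}
    (h : IsAlloc I.n I.m I.value I.copies P X) (hP : ∀ i j, i ≤ j → j < I.n → P j ≤ P i) :
    (I.solution P X).Feasible where
  supply i := by
    simp only [solution_x_eq_some]
    rw [card_filter_fin I.m fun b => X b = i + 1, ← I.copies_fin]
    exact h.supply i i.isLt
  affordable b i hb := by
    have := h.afford b b.isLt i (solution_x_eq_some.mp hb)
    rw [I.value_fin] at this
    exact Nat.cast_le.mpr this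
  ladder i j hij := by
    exact Nat.cast_le.mpr (hP i j hij j.isLt)

theorem Instance.solution_profit {I : Instance} {P X : ℕ → ℕ} (hX : ∀ b < I.m, X b ≤ I.n) :
    (I.solution P X).profit = ((∑ b ∈ range I.m, pay P X b : ℕ) : NNRat) := by
  rw [Solution.profit, Finset.sum_range, Nat.cast_sum]
  refine sum_congr rfl fun b _ => ?_
  have := hX b b.isLt
  by_cases h : X b = 0
  · simp [solution, pay, h]
  · simp [solution, pay, h, this]

theorem Instance.solution_isOutput {I : Instance} {τ : Mem} (h4 : ∀ i < I.n, τ 4 i = 1)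
    (hX : ∀ b < I.m, τ 5 b ≤ I.n) : (I.solution (τ 3) (τ 5)).IsOutput τ := by
  refine ⟨fun i => ?_, fun b => ?_⟩
  · simp [h4 i i.isLt, solution]
  · have := hX b b.isLt
    by_cases h : τ 5 b = 0
    · simp [solution, h]
    · simp only [solution, ne_eq, h, not_false_eq_true, this, and_self, dif_pos, Option.elim_some]
      omega

/-- Prices can be rounded to integers, and then to levels, at a small loss. -/
theorem exists_levels {I : Instance} {B L : ℕ}
    (hL : ∀ i < I.n, ∀ b < I.m, I.value i b < level B L) {S : Solution I} (hS : S.Feasible) :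
    ∃ lv x : ℕ → ℕ, (∀ i j, i ≤ j → j < I.n → lv j ≤ lv i) ∧ (∀ i < I.n, lv i ≤ L) ∧
      IsAlloc I.n I.m I.value I.copies (fun i => level B (lv i)) x ∧
      (B : NNRat) * S.profit ≤
        (B + 1) * ((∑ b ∈ range I.m, pay (fun i => level B (lv i)) x b : ℕ) : NNRat) := by
  -- Rounding up raises the profit and stays affordable, as values are integers.
  set p : ℕ → ℕ := fun i => if h : i < I.n then ⌈S.p ⟨i, h⟩⌉₊ else 0 with hp
  set lv : ℕ → ℕ := fun i => Nat.findGreatest (fun k => level B k ≤ p i) L with hlv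
  set x : ℕ → ℕ := fun b => if h : b < I.m then (S.x ⟨b, h⟩).elim 0 fun i => (i : ℕ) + 1 else 0
    with hx
  have hle : ∀ i, level B (lv i) ≤ p i := fun i =>
    Nat.findGreatest_spec (P := fun k => level B k ≤ p i) (Nat.zero_le L) (Nat.zero_le _)
  have hpanti : ∀ i j, i ≤ j → j < I.n → p j ≤ p i := by
    intro i j hij hj
    simp only [hp, hj, show i < I.n by omega, dif_pos]
    exact Nat.ceil_mono (hS.ladder (Fin.mk_le_mk.mpr hij))
  have hpv : ∀ (b : Fin I.m) (i : Fin I.n), S.x b = some i → p i ≤ I.v i b := by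
    intro b i hb
    simp only [hp, i.isLt, dif_pos]
    exact Nat.ceil_le.mpr (hS.affordable b i hb)
  have hx1 : ∀ (b : Fin I.m) (i : Fin I.n), x b = i + 1 ↔ S.x b = some i := by
    intro b i
    simp only [hx, b.isLt, dif_pos, Fin.eta]
    cases h : S.x b with
    | none => simp
    | some j => simp [Fin.ext_iff]
  have hxn : ∀ b < I.m, x b ≤ I.n := by
    intro b hb
    simp only [hx, hb, dif_pos]
    cases h : S.x ⟨b, hb⟩ with
    | none => simp
    | some j =>
      have := j.isLt
      simp only [Option.elim_some]
      omega
  refine ⟨lv, x, ?_, fun i _ => Nat.findGreatest_le L, ⟨hxn, ?_, ?_⟩, ?_⟩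
  · intro i j hij hj
    exact Nat.findGreatest_mono_left (fun k (hk : level B k ≤ p j) => hk.trans (hpanti i j hij hj)) L
  · intro b hb i hi
    have hin : i < I.n := by have := hxn b hb; omega
    have h := (hx1 ⟨b, hb⟩ ⟨i, hin⟩).mp hi
    have h' := (hle i).trans (hpv _ _ h)
    rwa [← I.value_fin] at h'
  · intro i hi
    have h := hS.supply ⟨i, hi⟩
    rw [← I.copies_fin] at h
    refine le_trans (le_of_eq ?_) h
    rw [sold, ← card_filter_fin I.m fun b => x b = i + 1]
    congr 1
    exact filter_congr fun b _ => hx1 b ⟨i, hi⟩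
  · rw [Solution.profit, Finset.sum_range, Nat.cast_sum, mul_sum, mul_sum]
    refine sum_le_sum fun b _ => ?_
    cases hb : S.x b with
    | none => simp
    | some i =>
      have hbi := (hx1 b i).mpr hb
      simp only [Option.elim_some, pay, hbi, Nat.add_eq_zero_iff, one_ne_zero, and_false, if_false,
        Nat.add_sub_cancel]
      have h1 : S.p i ≤ (p i : NNRat) := by
        simp only [hp, i.isLt, dif_pos, Fin.eta]
        exact Nat.le_ceil _
      -- The search bound `L` does not cut off the level of a sold item, since its price is at most
      -- a value and hence below `level B L`.
      have h2 : p i < level B (lv i + 1) := by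
        by_contra hcon
        push Not at hcon
        have h3 : lv i + 1 ≤ L := by
          by_contra hcon'
          have h4 := level_mono B (show L ≤ lv i + 1 by omega)
          have h5 := hL i i.isLt b b.isLt
          rw [I.value_fin] at h5
          have := hpv b i hb
          omega
        exact Nat.findGreatest_is_greatest (P := fun k => level B k ≤ p i) (Nat.lt_succ_self _) h3
          hcon
      have h3 : B * p i ≤ (B + 1) * level B (lv i) := by
        rw [level] at h2
        have := Nat.div_mul_le_self (level B (lv i)) B
        nlinarith
      calc (B : NNRat) * S.p i ≤ B * p i := by gcongr
        _ ≤ _ := by exact_mod_cast h3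

/-- Three losses of (B+1)/B each, from rounding, from the gaps and from bidders served twice, are
multiplied with the 2 of the greedy allocation. -/
theorem isApprox_of_table {I : Instance} {B G K L best a : ℕ} {D : ℕ → ℕ → ℕ} {P X : ℕ → ℕ}
    {ε : ℝ} (hB : 0 < B) (hBε : 14 ≤ ε * B) (hGB : G = B ^ 2) (hKB : K = B ^ 2 * (B + 1))
    (hL : ∀ i < I.n, ∀ b < I.m, I.value i b < level B L)
    (hout : IsPartial I.n I.m I.copies I.value B G a 0 best P X)
    (hD : ∀ a < L + K, ∀ d : ℕ → ℕ, (∀ l ≤ K, d l ≤ I.n) → d 0 ≤ d K → ∀ x,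
      IsAlloc I.n I.m I.value (blockCap I.copies G K d) (blockPrice B K d a) x →
      ∑ b ∈ range I.m, pay (blockPrice B K d a) x b + 2 * D (a + 1 - K) (d K) ≤
        2 * D (a + 1) (d 0))
    (hbest : ∀ a, 0 < a → a ≤ L + K → D a 0 ≤ best) :
    (I.solution P X).IsApprox (2 + ε) := by
  refine ⟨I.solution_feasible hout.alloc fun i j h1 h2 => hout.ladder i j (Nat.zero_le _) h1 h2,
    fun S hS => ?_⟩
  obtain ⟨lv, x, h1, h2, h3, h4⟩ := exists_levels hL hS
  have hK : 0 < K := by rw [hKB]; positivity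
  have h5 := sub_mul_sum_pay_le hK hD hbest h1 h2 h3
  have h6 := hout.val
  rw [I.solution_profit hout.alloc.le]
  set T := ∑ b ∈ range I.m, pay (fun i => level B (lv i)) x b
  set Q := ∑ b ∈ range I.m, pay P X b
  have hKG : K - G = B ^ 3 := by
    rw [hKB, hGB, mul_add, mul_one, Nat.add_sub_cancel]
    ring
  rw [hKG, hKB] at h5
  have h4' : (B : ℝ) * (S.profit : ℝ) ≤ (B + 1) * T := by exact_mod_cast h4
  have h5' : (B : ℝ) ^ 3 * T ≤ B ^ 2 * (B + 1) * (2 * best) := by exact_mod_cast h5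
  have h6' : (B : ℝ) * best ≤ (B + 1) * Q := by exact_mod_cast h6
  have hB' : (1 : ℝ) ≤ B := by exact_mod_cast hB
  have hQ : (((Q : ℕ) : NNRat) : ℝ) = Q := by norm_cast
  rw [hQ]
  have hQ0 : (0 : ℝ) ≤ Q := Nat.cast_nonneg _
  set β : ℝ := (B : ℝ)
  have key : β ^ 3 * (S.profit : ℝ) ≤ 2 * (β + 1) ^ 3 * Q := by
    refine le_of_mul_le_mul_left ?_ (show (0 : ℝ) < β ^ 2 by positivity)
    calc β ^ 2 * (β ^ 3 * (S.profit : ℝ)) = β * (β ^ 3 * (β * (S.profit : ℝ))) := by ring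
      _ ≤ β * (β ^ 3 * ((β + 1) * T)) := by gcongr
      _ = β * (β + 1) * (β ^ 3 * T) := by ring
      _ ≤ β * (β + 1) * (β ^ 2 * (β + 1) * (2 * best)) := by gcongr
      _ = 2 * β ^ 2 * (β + 1) ^ 2 * (β * best) := by ring
      _ ≤ 2 * β ^ 2 * (β + 1) ^ 2 * ((β + 1) * Q) := by gcongr
      _ = β ^ 2 * (2 * (β + 1) ^ 3 * Q) := by ring
  refine le_of_mul_le_mul_left (key.trans ?_) (show (0 : ℝ) < β ^ 3 by positivity)
  rw [← mul_assoc]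
  refine mul_le_mul_of_nonneg_right ?_ hQ0
  -- It remains that 6β² + 6β + 2 ≤ εβ³; as β ≥ 1, the left side is at most 14β².
  have h7 : 14 * β ^ 2 ≤ ε * β * β ^ 2 := by gcongr
  nlinarith

end MaxBuyingPLLimited

namespace RAM

/-! ### Polynomial time for families of inputs -/

section Family
variable {ι : Type*} (sz : ι → ℕ)

/-- The length of the numbers in the memories is polynomial in the size of the input. -/
def Small (f : ι → Mem) : Prop := ∃ l, PolyBounded l ∧ ∀ x, (f x).Bounded (l (sz x))

/-- The program turns the memories `f x` into `g x` in polynomial time. -/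
def PolyRuns (c : Prog) (f g : ι → Mem) : Prop :=
  ∃ t, PolyBounded t ∧ ∀ x, ∃ T, Runs c (f x) (g x) T ∧ T ≤ t (sz x)

variable {sz}

theorem PolyRuns.seq {c d : Prog} {f g h : ι → Mem} (hc : PolyRuns sz c f g)
    (hd : PolyRuns sz d g h) : PolyRuns sz (.seq c d) f h := by
  obtain ⟨t, ht, hrt⟩ := hc
  obtain ⟨u, hu, hru⟩ := hd
  refine ⟨_, ht.add hu, fun x => ?_⟩
  obtain ⟨T, hT, hT'⟩ := hrt x
  obtain ⟨U, hU, hU'⟩ := hru x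
  exact ⟨_, .seq hT hU, add_le_add hT' hU'⟩

theorem PolyRuns.write {f : ι → Mem} (hf : Small sz f) (a : ℕ) (e : Expr) {d : Expr}
    (hd : d.Additive) :
    PolyRuns sz (.write a e d) f (fun x => (f x).set a (e.eval (f x)) (d.eval (f x))) ∧
      Small sz (fun x => (f x).set a (e.eval (f x)) (d.eval (f x))) := by
  obtain ⟨l, hl, hfl⟩ := hf
  refine ⟨⟨fun s => 2 * (e.weight + d.weight) * (l s + 1), (PolyBounded.const _).mul
    (hl.add (.const 1)), fun x => runs_write _ a e d (hfl x)⟩,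
    ⟨fun s => l s + d.growth, hl.add (.const _), fun x => ?_⟩⟩
  exact ((hfl x).mono (Nat.le_add_right _ _)).set (d.size_eval_le _ _ (hfl x) hd)

theorem PolyRuns.exec {f : ι → Mem} (hf : Small sz f) {X : ℕ → ℕ} (hX : PolyBounded X)
    (hfX : ∀ x p, f x bnd p ≤ X (sz x)) {c : BProg} (hc : c.WF) (hb : ¬ c.Writes bnd) :
    PolyRuns sz c.toProg f (fun x => c.exec (f x)) ∧ Small sz (fun x => c.exec (f x)) := by
  obtain ⟨l, hl, hfl⟩ := hf
  have hg := c.grow_polyBounded.comp hX c.grow_mono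
  have ht := c.time_polyBounded.comp hX c.time_mono
  have h := fun x => BProg.runs (X (sz x)) hc hb (hfl x) (hfX x)
  exact ⟨⟨_, ht.mul ((hl.add hg).add (.const 1)), fun x => (h x).1⟩, ⟨_, hl.add hg,
    fun x => (h x).2⟩⟩

/-- A loop whose number of passes is not stored in the array of bounds. One pass adds the same
number of digits each time, because the loop bounds inside it do not change; polynomially many
passes therefore keep the numbers polynomially long. -/
theorem PolyRuns.loop {f : ι → Mem} (hf : Small sz f) {X : ℕ → ℕ} (hX : PolyBounded X)
    (hfX : ∀ x p, f x bnd p ≤ X (sz x)) {c : BProg} (hc : c.WF) (hb : ¬ c.Writes bnd)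
    {e : Expr} {N : ι → ℕ} {N' : ℕ → ℕ} (hN' : PolyBounded N') (hN : ∀ x, N x ≤ N' (sz x))
    (htest : ∀ x, ∀ k < N x, e.eval (c.exec^[k] (f x)) ≠ 0)
    (hhalt : ∀ x, e.eval (c.exec^[N x] (f x)) = 0) :
    PolyRuns sz (.loop e c.toProg) f (fun x => c.exec^[N x] (f x)) ∧
      Small sz (fun x => c.exec^[N x] (f x)) := by
  obtain ⟨l, hl, hfl⟩ := hf
  have hg := c.grow_polyBounded.comp hX c.grow_mono
  have ht := c.time_polyBounded.comp hX c.time_mono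
  have hrow : ∀ x k, (c.exec^[k] (f x)) bnd = f x bnd := by
    intro x k
    induction k with
    | zero => rfl
    | succ k ih => rw [Function.iterate_succ_apply', BProg.exec_row hb, ih]
  have hbd : ∀ x k, (c.exec^[k] (f x)).Bounded (l (sz x) + k * c.grow (X (sz x))) := by
    intro x k
    induction k with
    | zero => simpa using hfl x
    | succ k ih =>
      have := (BProg.runs (X (sz x)) hc hb ih (by simpa [hrow] using hfX x)).2
      rw [Function.iterate_succ_apply']
      exact this.mono (le_of_eq (by ring))
  have hle : ∀ x, ∀ k ≤ N x, l (sz x) + k * c.grow (X (sz x)) ≤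
      l (sz x) + N' (sz x) * c.grow (X (sz x)) := by
    intro x k hk
    gcongr
    exact hk.trans (hN x)
  refine ⟨⟨fun s => (N' s + 1) * (e.weight * (l s + N' s * c.grow (X s) + 1) +
    c.time (X s) * (l s + N' s * c.grow (X s) + c.grow (X s) + 1)), ?_, fun x => ?_⟩,
    ⟨fun s => l s + N' s * c.grow (X s), hl.add (hN'.mul hg), fun x =>
      (hbd x (N x)).mono (hle x _ le_rfl)⟩⟩
  · exact (hN'.add (.const 1)).mul (((PolyBounded.const _).mul ((hl.add (hN'.mul hg)).add
      (.const 1))).add (ht.mul (((hl.add (hN'.mul hg)).add hg).add (.const 1))))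
  · have hcost : ∀ k ≤ N x, e.cost (c.exec^[k] (f x)) ≤
        e.weight * (l (sz x) + N' (sz x) * c.grow (X (sz x)) + 1) := fun k hk =>
      e.cost_le _ _ ((hbd x k).mono (hle x k hk))
    obtain ⟨T, hT, hT'⟩ := runs_loop_iterate (e := e) (c := c.toProg)
      (f := fun k => c.exec^[k] (f x)) (N := N x)
      (W := e.weight * (l (sz x) + N' (sz x) * c.grow (X (sz x)) + 1) +
        c.time (X (sz x)) * (l (sz x) + N' (sz x) * c.grow (X (sz x)) + c.grow (X (sz x)) + 1))
      (by
        intro k hk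
        obtain ⟨T, hT, hT'⟩ := (BProg.runs (X (sz x)) hc hb ((hbd x k).mono (hle x k hk.le))
          (by simpa [hrow] using hfX x)).1
        rw [Function.iterate_succ_apply']
        exact ⟨T, hT, add_le_add (hcost k hk.le) hT'⟩)
      (htest x) (hhalt x) ((hcost _ le_rfl).trans (Nat.le_add_right _ _))
    exact ⟨T, hT, hT'.trans (Nat.mul_le_mul_right _ (Nat.succ_le_succ (hN x)))⟩

end Family
end RAM

namespace MaxBuyingPLLimited
open RAM

/-! ### The algorithm -/

theorem Instance.n_le_size (I : Instance) : I.n ≤ I.size := by unfold size; omega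

theorem Instance.m_le_size (I : Instance) : I.m ≤ I.size := by unfold size; omega

theorem Instance.input_bounded (I : Instance) : I.input.Bounded I.size := by
  have hn : ∀ k, Nat.size k ≤ k := fun k => Nat.size_le.mpr Nat.lt_two_pow_self
  have hC : ∀ i, Nat.size (I.C i) ≤ I.size := by
    intro i
    have := single_le_sum (f := fun i => RAM.len (I.C i)) (fun _ _ => Nat.zero_le _) (mem_univ i)
    simp only [RAM.len] at this
    unfold size
    simp only [RAM.len]
    omega
  have hv : ∀ i b, Nat.size (I.v i b) ≤ I.size := by
    intro i b
    have h1 := single_le_sum (f := fun b => RAM.len (I.v i b)) (fun _ _ => Nat.zero_le _)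
      (mem_univ b)
    have h2 := single_le_sum (f := fun i => ∑ b, RAM.len (I.v i b)) (fun _ _ => Nat.zero_le _)
      (mem_univ i)
    simp only [RAM.len] at h1 h2
    unfold size
    simp only [RAM.len]
    omega
  intro a k
  unfold input
  split_ifs
  · exact (hn _).trans I.n_le_size
  · exact (hn _).trans I.m_le_size
  · simp
  · exact hC _
  · simp
  · exact hv _ _
  · simp
  · simp

theorem Instance.input_value (I : Instance) {i b : ℕ} (hi : i < I.n) (hb : b < I.m) :
    I.input 2 (i * I.m + b) = I.value i b := by
  have h1 : (i * I.m + b) / I.m = i := by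
    rw [Nat.mul_comm, Nat.mul_add_div (by omega), Nat.div_eq_of_lt hb, add_zero]
  have h2 : (i * I.m + b) % I.m = b := by
    rw [Nat.mul_comm, Nat.mul_add_mod, Nat.mod_eq_of_lt hb]
  simp [input, value, h1, h2, hi, hb]

/-! ### Determining the number of price levels -/

/-- The sum of all entries of the valuation matrix. -/
def total : BProg :=
  .iter 21 0 (.iter 22 1 (.write 17 0 (.var 17 + .read 2 (.var 21 * .read 6 1 + .var 22))))

theorem le_exec_total {n m : ℕ} {v : ℕ → ℕ → ℕ} (σ : Mem) (h0 : σ 6 0 = n) (h1 : σ 6 1 = m)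
    (hv : ∀ i < n, ∀ b < m, σ 2 (i * m + b) = v i b) :
    ∀ i < n, ∀ b < m, v i b ≤ total.exec σ 17 0 := by
  have h := BProg.exec_iter (i := 21) (p := 0)
    (c := .iter 22 1 (.write 17 0 (.var 17 + .read 2 (.var 21 * .read 6 1 + .var 22))))
    (σ := σ) (N := n) (fun k τ => τ 2 = σ 2 ∧ τ 6 = σ 6 ∧ ∀ i < k, ∀ b < m, v i b ≤ τ 17 0) h0
    (by simp [Mem.set_row_of_ne]) ?_
  · exact h.2.2
  rintro k τ hk hcnt ⟨e2, e6, hle⟩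
  have h := BProg.exec_iter (i := 22) (p := 1)
    (c := .write 17 0 (.var 17 + .read 2 (.var 21 * .read 6 1 + .var 22)))
    (σ := τ) (N := m) (fun j υ => υ 2 = σ 2 ∧ υ 6 = σ 6 ∧ υ 21 = τ 21 ∧ τ 17 0 ≤ υ 17 0 ∧
      ∀ b < j, v k b ≤ υ 17 0) (by rw [← h1, ← e6])
    (by simp [Mem.set_row_of_ne, e2, e6]) ?_
  · obtain ⟨i1, i2, -, i4, i5⟩ := h
    refine ⟨?_, ?_, ?_⟩
    · rw [Mem.set_row_of_ne (by simp), i1]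
    · rw [Mem.set_row_of_ne (by simp), i2]
    · rw [Mem.set_row_of_ne (by simp)]
      intro i hi b hb
      rcases Nat.lt_succ_iff_lt_or_eq.mp hi with h | rfl
      · exact (hle i h b hb).trans i4
      · exact i5 b hb
  · rintro j υ hj hcj ⟨f2, f6, f21, fle, fv⟩
    have hval : (.var 17 + .read 2 (.var 21 * .read 6 1 + .var 22) : Expr).eval υ =
        υ 17 0 + v k j := by
      simp only [Expr.eval_add, Expr.eval_var, Expr.eval_read, Expr.eval_mul, Expr.eval_one, f2,
        f6, f21, hcnt, hcj, h1, hv k hk j hj]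
    have e17 : (((BProg.write 17 0 (.var 17 + .read 2 (.var 21 * .read 6 1 + .var 22))).exec
        υ).set 22 0 (j + 1)) 17 0 = υ 17 0 + v k j := by
      rw [Mem.set_row_of_ne (by simp), BProg.exec, hval]
      simp [Mem.set]
    rw [e17]
    refine ⟨?_, ?_, ?_, by omega, ?_⟩
    · rw [Mem.set_row_of_ne (by simp), BProg.exec, Mem.set_row_of_ne (by simp), f2]
    · rw [Mem.set_row_of_ne (by simp), BProg.exec, Mem.set_row_of_ne (by simp), f6]
    · rw [Mem.set_row_of_ne (by simp), BProg.exec, Mem.set_row_of_ne (by simp), f21]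
    · intro b hb
      rcases Nat.lt_succ_iff_lt_or_eq.mp hb with h | rfl
      · exact (fv b h).trans (Nat.le_add_right _ _)
      · exact Nat.le_add_left _ _

/-- One step of the search for a power of two above the total of all values. -/
def double (B : ℕ) : BProg :=
  .seq (.write 18 0 (.var 18 + .var 18)) (.write 23 0 (.var 23 + .const B))

/-- Each doubling of the power of two is matched by `B` further levels, in accordance with
`two_pow_le_level`. -/
theorem exec_double_iterate (B k : ℕ) (σ : Mem) :
    ((double B).exec^[k] σ) 18 0 = 2 ^ k * σ 18 0 ∧ ((double B).exec^[k] σ) 23 0 = σ 23 0 + k * B ∧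
      ∀ a, a ≠ 18 → a ≠ 23 → ((double B).exec^[k] σ) a = σ a := by
  induction k with
  | zero => simp
  | succ k ih =>
    obtain ⟨h1, h2, h3⟩ := ih
    rw [Function.iterate_succ_apply']
    set τ := (double B).exec^[k] σ
    refine ⟨?_, ?_, fun a ha ha' => ?_⟩
    · simp [double, BProg.exec, Mem.set, h1]
      ring
    · simp [double, BProg.exec, Mem.set, h2]
      ring
    · simp only [double, BProg.exec]
      rw [Mem.set_row_of_ne ha', Mem.set_row_of_ne ha, h3 a ha ha']

theorem solve_wf (B G K : ℕ) : (solve B G K).WF := by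
  have hb : (body G K).WF := by
    simp [body, greedy, sell, update, combine, newPos, BProg.WF, BProg.Writes, priceExpr, capExpr]
  have hn := nest_wf hb (fun a ha h => by have := body_writes h; omega) (K + 1)
  have hf : finish.WF := by simp [finish, BProg.WF, BProg.Writes]
  refine ⟨by simp [BProg.WF, BProg.Writes], by simp [BProg.WF, BProg.Writes], ⟨hn, hf⟩, ?_⟩
  rw [BProg.Writes, nest_writes]
  rintro ((h | ⟨l, _, h⟩) | h)
  · have := body_writes h
    omega
  · omega
  · have := finish_writes h
    omega

theorem solve_writes (B G K : ℕ) : ¬ (solve B G K).Writes bnd := by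
  change ¬ (solve B G K).Writes 6
  rw [solve]
  simp only [BProg.Writes, nest_writes]
  rintro (h | h | h | (h | ⟨l, _, h⟩) | h)
  · omega
  · omega
  · omega
  · have := body_writes h
    omega
  · omega
  · have := finish_writes h
    omega

/-! ### Assembling the algorithm -/

/-- The whole algorithm. -/
def algorithm (B G K : ℕ) : Prog :=
  .seq (.write 6 0 (.read 0 0)) (.seq (.write 6 1 (.read 0 1))
    (.seq (.write 6 (.const 2) (.read 0 0 + 1)) (.seq total.toProg
      (.seq (.write 18 0 1) (.seq (.write 23 0 (.const (1 + K)))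
        (.seq (.loop (.var 17 + 1 - .var 18) (double B).toProg)
          (.seq (.write 6 (.const 3) (.var 23)) (solve B G K).toProg)))))))

/-- The loop bounds are written between the bounded programs, never inside them. With `L = 1 + B *
size` of the total value, level `L` exceeds every value; `K` more rounds provide all the starting
positions of the shifting argument. -/
theorem exists_polyRuns {B : ℕ} (hB : 0 < B) (G K : ℕ) :
    ∃ (f : Instance → Mem) (L : Instance → ℕ),
      PolyRuns Instance.size (algorithm B G K) Instance.input (fun I => (solve B G K).exec (f I)) ∧
      ∀ I : Instance, (∀ i < I.n, ∀ b < I.m, I.value i b < level B (L I)) ∧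
        f I 6 0 = I.n ∧ f I 6 1 = I.m ∧ f I 6 2 = I.n + 1 ∧ f I 6 3 = L I + K ∧
        (∀ i < I.n, f I 1 i = I.copies i) ∧
        (∀ i < I.n, ∀ b < I.m, f I 2 (i * I.m + b) = I.value i b) ∧
        ∀ a, a = 3 ∨ a = 5 ∨ a = 7 ∨ a = 8 ∨ a = 9 ∨ a = 10 ∨ a = 19 → ∀ k, f I a k = 0 := by
  have s₀ : Small Instance.size Instance.input := ⟨_, .id, Instance.input_bounded⟩
  obtain ⟨p₁, s₁⟩ := PolyRuns.write s₀ 6 0 (d := .read 0 0) trivial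
  set f₁ : Instance → Mem := fun I => I.input.set 6 _ _ with hf₁
  obtain ⟨p₂, s₂⟩ := PolyRuns.write s₁ 6 1 (d := .read 0 1) trivial
  set f₂ : Instance → Mem := fun I => (f₁ I).set 6 _ _ with hf₂
  obtain ⟨p₃, s₃⟩ := PolyRuns.write s₂ 6 (.const 2) (d := .read 0 0 + 1)
    (by simp)
  set f₃ : Instance → Mem := fun I => (f₂ I).set 6 _ _ with hf₃
  have row₃ : ∀ I a, a ≠ 6 → f₃ I a = I.input a := by
    intro I a ha
    simp only [hf₃, hf₂, hf₁, Mem.set_row_of_ne ha]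
  have b₃ : ∀ I p, f₃ I bnd p = if p = 0 then I.n else if p = 1 then I.m else
      if p = 2 then I.n + 1 else 0 := by
    intro I p
    simp only [hf₃, hf₂, hf₁, Mem.set, Expr.eval_read, Expr.eval_zero, Expr.eval_one,
      Expr.eval_const, Expr.eval_add, Instance.input]
    rcases p with _ | _ | _ | p <;> simp
  have X₃ : ∀ I p, f₃ I bnd p ≤ I.size + 1 := by
    intro I p
    have := I.n_le_size
    have := I.m_le_size
    rw [b₃]
    split_ifs <;> omega
  obtain ⟨p₄, s₄⟩ := PolyRuns.exec s₃ (PolyBounded.id.add (.const 1)) X₃ (c := total)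
    (by simp [total, BProg.WF, BProg.Writes]) (by simp [total, BProg.Writes])
  set f₄ : Instance → Mem := fun I => total.exec (f₃ I) with hf₄
  have row₄ : ∀ I a, a ≠ 17 → a ≠ 21 → a ≠ 22 → f₄ I a = f₃ I a := by
    intro I a h1 h2 h3
    exact BProg.exec_row (by simp [total, BProg.Writes, *]) _
  have v₄ : ∀ I : Instance, ∀ i < I.n, ∀ b < I.m, I.value i b ≤ f₄ I 17 0 := by
    intro I
    refine le_exec_total (f₃ I) (by rw [b₃]; simp) (by rw [b₃]; simp) fun i hi b hb => ?_
    rw [row₃ I 2 (by simp), I.input_value hi hb]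
  obtain ⟨p₅, s₅⟩ := PolyRuns.write s₄ 18 0 (d := 1) trivial
  set f₅ : Instance → Mem := fun I => (f₄ I).set 18 _ _ with hf₅
  obtain ⟨p₆, s₆⟩ := PolyRuns.write s₅ 23 0 (d := .const (1 + K)) trivial
  set f₆ : Instance → Mem := fun I => (f₅ I).set 23 _ _ with hf₆
  have row₆ : ∀ I a, a ≠ 23 → a ≠ 18 → f₆ I a = f₄ I a := by
    intro I a h1 h2
    simp only [hf₆, hf₅, Mem.set_row_of_ne h1, Mem.set_row_of_ne h2]
  have b₆ : ∀ I, f₆ I 6 = f₃ I 6 := fun I => by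
    rw [row₆ I 6 (by simp) (by simp), row₄ I 6 (by simp) (by simp) (by simp)]
  have w₆ : ∀ I, f₆ I 18 0 = 1 := fun I => by simp [hf₆, hf₅, Mem.set]
  have a₆ : ∀ I, f₆ I 23 0 = 1 + K := fun I => by simp [hf₆, Mem.set]
  obtain ⟨l, hl, hfl⟩ := s₆
  have hit := fun I k => exec_double_iterate B k (f₆ I)
  have htest : ∀ I k, (.var 17 + 1 - .var 18 : Expr).eval ((double B).exec^[k] (f₆ I)) =
      f₆ I 17 0 + 1 - 2 ^ k := by
    intro I k
    simp only [Expr.eval_sub, Expr.eval_add, Expr.eval_var, Expr.eval_one, (hit I k).1, w₆,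
      (hit I k).2.2 17 (by simp) (by simp), mul_one]
  obtain ⟨p₇, s₇⟩ := PolyRuns.loop ⟨l, hl, hfl⟩ (PolyBounded.id.add (.const 1))
    (fun I p => by rw [b₆]; exact X₃ I p) (c := double B)
    (by simp [double, BProg.WF]) (by simp [double, BProg.Writes])
    -- The loop stops at the first power of two above the total, after as many passes as the total
    -- has digits. The bound `l` on the digits of all numbers in memory also bounds this count.
    (e := .var 17 + 1 - .var 18) (N := fun I => Nat.size (f₆ I 17 0)) hl (fun I => hfl I 17 0)
    (fun I k hk => by
      rw [htest]
      have := Nat.lt_size.mp hk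
      omega)
    (fun I => by
      rw [htest]
      have := Nat.lt_size_self (f₆ I 17 0)
      omega)
  set f₇ : Instance → Mem := fun I => (double B).exec^[Nat.size (f₆ I 17 0)] (f₆ I) with hf₇
  obtain ⟨p₈, s₈⟩ := PolyRuns.write s₇ 6 (.const 3) (d := .var 23) trivial
  set f₈ : Instance → Mem := fun I => (f₇ I).set 6 _ _ with hf₈
  have a₇ : ∀ I, f₇ I 23 0 = 1 + K + Nat.size (f₆ I 17 0) * B := fun I => by
    rw [← a₆ I]
    exact (hit I _).2.1
  have row₈ : ∀ I a, a ≠ 6 → a ≠ 17 → a ≠ 18 → a ≠ 21 → a ≠ 22 → a ≠ 23 → f₈ I a = I.input a := by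
    intro I a h1 h2 h3 h4 h5 h6
    simp only [hf₈]
    rw [Mem.set_row_of_ne h1]
    exact ((hit I _).2.2 a h3 h6).trans
      ((row₆ I a h6 h3).trans ((row₄ I a h2 h4 h5).trans (row₃ I a h1)))
  have b₈ : ∀ I p, f₈ I bnd p = if p = 3 then 1 + K + Nat.size (f₆ I 17 0) * B
      else f₃ I bnd p := by
    intro I p
    rw [← b₆ I, ← (hit I (Nat.size (f₆ I 17 0))).2.2 6 (by simp) (by simp), ← a₇ I]
    simp only [hf₈, Mem.set_apply_same_row, Expr.eval_const, Expr.eval_var]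
    rfl
  obtain ⟨p₉, -⟩ := PolyRuns.exec s₈ (X := fun s => (s + 1) + (1 + K + l s * B))
    ((PolyBounded.id.add (.const 1)).add ((PolyBounded.const _).add (hl.mul (.const B))))
    (fun I p => by
      rw [b₈]
      have h1 := X₃ I p
      have h2 := Nat.mul_le_mul_right B (hfl I 17 0)
      split_ifs <;> omega)
    (solve_wf B G K) (solve_writes B G K)
  refine ⟨f₈, fun I => 1 + B * Nat.size (f₆ I 17 0),
    p₁.seq (p₂.seq (p₃.seq (p₄.seq (p₅.seq (p₆.seq (p₇.seq (p₈.seq p₉))))))), fun I => ?_⟩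
  refine ⟨?_, by simp [b₈, b₃], by simp [b₈, b₃], by simp [b₈, b₃], ?_, ?_, ?_, ?_⟩
  · intro i hi b hb
    refine lt_of_lt_of_le ?_ (two_pow_le_level hB _)
    have h := v₄ I i hi b hb
    rw [← row₆ I 17 (by simp) (by simp)] at h
    exact h.trans_lt (Nat.lt_size_self _)
  · rw [b₈, if_pos rfl]
    ring
  · intro i hi
    rw [row₈ I 1 (by simp) (by simp) (by simp) (by simp) (by simp) (by simp)]
    simp [Instance.input, Instance.copies]
  · intro i hi b hb
    rw [row₈ I 2 (by simp) (by simp) (by simp) (by simp) (by simp) (by simp), I.input_value hi hb]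
  · intro a ha k
    rw [row₈ I a (by omega) (by omega) (by omega) (by omega) (by omega) (by omega)]
    simp only [Instance.input]
    rw [if_neg (by omega), if_neg (by omega), if_neg (by omega)]

end MaxBuyingPLLimited

end

open MaxBuyingPLLimited in
theorem mainTheorem2 (ε : ℝ) (hε₀ : 0 < ε) (hε₁ : ε < 1) :
    MaxBuyingPLLimited.HasPolyTimeApprox (2 + ε) := by
  -- The 14 is 6 + 6 + 2, from 2(1 + 1/B)³ = 2 + 6/B + 6/B² + 2/B³ ≤ 2 + 14/B.
  obtain ⟨B, hBε⟩ := exists_nat_ge (14 / ε)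
  have hB : 0 < B := by
    have : (0 : ℝ) < B := lt_of_lt_of_le (by positivity) hBε
    exact_mod_cast this
  rw [div_le_iff₀ hε₀, mul_comm] at hBε
  have hK : 0 < B ^ 2 * (B + 1) := by positivity
  obtain ⟨f, L, ⟨t, ⟨q, hq⟩, hruns⟩, hf⟩ := exists_polyRuns hB (B ^ 2) (B ^ 2 * (B + 1))
  refine ⟨algorithm B (B ^ 2) (B ^ 2 * (B + 1)), q, fun I => ?_⟩
  obtain ⟨T, hT, hTt⟩ := hruns I
  obtain ⟨hL, h0, h1, h2, h3, hC, hv, hz⟩ := hf I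
  obtain ⟨h4, best, D, ⟨a, hout⟩, hD, hbest⟩ := exec_solve (f I) hK (mul_level_le_level_add_sq hB)
    h0 h1 h2 h3 hC hv hz
  exact ⟨_, T, hT, hTt.trans (hq _), _, I.solution_isOutput h4 hout.alloc.le,
    isApprox_of_table hB hBε rfl rfl hL hout hD hbest⟩
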